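/- Let $m\ge 1$ be a known integer. A mixing distribution of order $m$ is $G=\sum_{j=1}^m\alpha_j\,\delta_{(\theta_j,\sigma_j^2)}$, given by proportions $\alpha_j\ge 0$ with $\sum_{j}\alpha_j=1$, means $\theta_j\in\mathbb R$ and standard deviations $\sigma_j>0$ (some $\alpha_j$ may be $0$ and components may coincide); write $\mathbb G_m$ for the set of these, $G(t,v)=\sum_{j=1}^m\alpha_j I(\theta_j\le t,\ \sigma_j^2\le v)$ for the c.d.f., and $f(x;G)=\sum_{j=1}^m\alpha_j\,\phi(x;\theta_j,\sigma_j^2)$, where $\phi(\cdot;\theta,\sigma^2)$ is the density of $N(\theta,\sigma^2)$. Let $$D_{KW}(G_1,G_2)=\int_{\mathbb R}\int_0^\infty |G_1(t,v)-G_2(t,v)|\,e^{-|t|-|v|}\,dv\,dt .$$ Let $G^*\in\mathbb G_m$ and let $X_1,X_2,\dots$ be i.i.d. with density $f(\cdot;G^*)$. For each sample size $n$ let $p_n$ be a real penalty function on $\mathbb G_m$, where $p_n$ and $\tilde p_n$ may depend on the data, such that, almost surely: - **P1.** $p_n(G)=\sum_{j=1}^m\tilde p_n(\sigma_j)$ for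 a function $\tilde p_n:(0,\infty)\to\mathbb R$, for all $n$ and $G\in\mathbb G_m$; - **P2.** $\sup_{\sigma>0}[\tilde p_n(\sigma)]^+=o(n)$, and $\tilde p_n(\sigma)=o(n)$ for each fixed $\sigma>0$; - **P3.** for all sufficiently large $n$, $\tilde p_n(\sigma)<(\log n)^2\log\sigma$ for all $0<\sigma<n^{-1}\log n$. Let $\tilde G_n$ be a penalized maximum likelihood estimator, that is, almost surely, for all sufficiently large $n$, $\tilde G_n$ is a global maximum point over $\mathbb G_m$ of $$\tilde\ell_n(G)=\sum_{i=1}^n\log f(X_i;G)+p_n(G).$$ Then $\tilde G_n$ is strongly consistent: $D_{KW}(\tilde G_n,G^*)\to 0$ almost surely as $n\to\infty$. -/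

import Mathlib

open Filter Topology MeasureTheory ProbabilityTheory Asymptotics
open scoped NNReal ENNReal

/-- A mixing distribution of order `m` on `ℝ × (0, ∞)` for the normal mixture model:
`m` components with mixing proportions `weight j`, means `mean j` and standard deviations `sd j`.
Some proportions may vanish and some components may coincide. -/
structure NormalMixing (m : ℕ) where
  /-- mixing proportions -/
  weight : Fin m → ℝ
  /-- component means -/
  mean : Fin m → ℝ
  /-- component standard deviations -/
  sd : Fin m → ℝ
  weight_nonneg : ∀ j, 0 ≤ weight j
  weight_sum : ∑ j, weight j = 1
  sd_pos : ∀ j, 0 < sd j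

namespace NormalMixing

variable {m : ℕ}

/-- The mixture density `f(x; G) = ∑ j, α_j φ(x; θ_j, σ_j²)`. -/
noncomputable def density (G : NormalMixing m) (x : ℝ) : ℝ :=
  ∑ j, G.weight j * gaussianPDFReal (G.mean j) (Real.toNNReal (G.sd j ^ 2)) x

/-- The probability measure on `ℝ` with density `f(·; G)`. -/
noncomputable def law (G : NormalMixing m) : Measure ℝ :=
  volume.withDensity (fun x => ENNReal.ofReal (G.density x))

open scoped Classical in
/-- The bivariate c.d.f. in (mean, variance):
`G(t, v) = ∑ j, α_j I(θ_j ≤ t, σ_j² ≤ v)`. -/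
noncomputable def cdf (G : NormalMixing m) (t v : ℝ) : ℝ :=
  ∑ j, G.weight j * (if G.mean j ≤ t ∧ G.sd j ^ 2 ≤ v then 1 else 0)

/-- The Kiefer–Wolfowitz distance
`∫_{ℝ × (0, ∞)} |G₁(t, v) - G₂(t, v)| exp(-(|t| + |v|)) dt dv`. -/
noncomputable def kwDist (G₁ G₂ : NormalMixing m) : ℝ :=
  ∫ z in (Set.univ : Set ℝ) ×ˢ Set.Ioi (0 : ℝ),
    |G₁.cdf z.1 z.2 - G₂.cdf z.1 z.2| * Real.exp (-(|z.1| + |z.2|))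

/-- The log-likelihood `ℓ_n(G) = ∑_{i < n} log f(x_i; G)` of the first `n` observations. -/
noncomputable def logLik (x : ℕ → ℝ) (n : ℕ) (G : NormalMixing m) : ℝ :=
  ∑ i ∈ Finset.range n, Real.log (G.density (x i))

/-- `G` is a penalized MLE of order `m` for the first `n` observations and the penalty `pen`:
a global maximum point of `ℓ_n + pen` over all mixing distributions of order `m`. -/
def IsPenalizedMLE (x : ℕ → ℝ) (n : ℕ) (pen : NormalMixing m → ℝ) (G : NormalMixing m) : Prop :=
  ∀ G' : NormalMixing m, logLik x n G' + pen G' ≤ logLik x n G + pen G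

/-- P1, additivity: `p_n(G) = ∑ j, q_n(σ_j)` for all `n` and `G`. -/
def PenaltyAdditive (p : ℕ → NormalMixing m → ℝ) (q : ℕ → ℝ → ℝ) : Prop :=
  ∀ n G, p n G = ∑ j, q n (G.sd j)

end NormalMixing

/-- P2: `sup_{σ > 0} [q_n(σ)]⁺ = o(n)`, and `q_n(σ) = o(n)` for each `σ > 0`. -/
def PenaltyModerate (q : ℕ → ℝ → ℝ) : Prop :=
  (∀ ε : ℝ, 0 < ε → ∀ᶠ n : ℕ in atTop, ∀ σ : ℝ, 0 < σ → max (q n σ) 0 ≤ ε * n) ∧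
  (∀ σ : ℝ, 0 < σ → (fun n : ℕ => q n σ) =o[atTop] (fun n : ℕ => (n : ℝ)))

/-- P3: for all large `n`, `q_n(σ) < (log n)² log σ` whenever `0 < σ < n⁻¹ log n`. -/
def PenaltySevere (q : ℕ → ℝ → ℝ) : Prop :=
  ∀ᶠ n : ℕ in atTop, ∀ σ : ℝ, 0 < σ → σ < (n : ℝ)⁻¹ * Real.log n →
    q n σ < Real.log n ^ 2 * Real.log σ

/-!
# Strong consistency of penalized maximum likelihood for normal mixtures

The likelihood of a normal mixture is unbounded, because a component may collapse onto an
observation. The penalty prevents this, and once the collapsing components are out of the way the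
classical argument of Wald applies.

*Collapsing components.* If `h` is the part of the mixture density formed by the components that
do not collapse and `b_j` are the densities of those that do, then
`log (h + ∑ b_j) ≤ log (h + ε) + ∑ log (1 + b_j / ε)`, so that each collapsing component can be
treated on its own (`NormalMixing.log_density_le`). Almost surely, every interval of length `2 r`
contains `O(n r + log n)` observations, uniformly in its position and length
(`ae_exists_obsCount_closedBall_le`; a union bound over cells of length about `log n / n` and the
Borel–Cantelli lemma). A component with standard deviation `σ` only matters for the observations
within `σ |log σ|` of its mean and adds about `|log σ|` for each of them, hence
`O(n σ |log σ|² + log n |log σ|)` in total. The first term is a small fraction of `n` when `σ` is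
small; the second one is `o(n)` if `σ ≥ log n / n` and is absorbed by the penalty
`(log n)² log σ` otherwise (`exists_sd_bound`).

*The remaining components.* Along a subsequence, each of them converges to a normal component or
escapes to infinity with a density tending to zero (`NormalMixing.exists_subseq_limit`), so `h`
converges to a normal mixture `H` of total mass at most one. The functions `log (h + ε)` are
uniformly bounded and uniformly Lipschitz, and for such functions the law of large numbers holds
uniformly (`eventually_forall_abs_average_sub_integral_le`). Comparing the penalized likelihoods
of the estimator and of the true mixture `f` gives `E log f ≤ E log (H + ε)` for all `ε > 0`
(`NormalMixing.integral_log_density_le_of_isPenalizedMLE`), which forces `H = f` by Jensen's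
inequality (`normalMix_eq_density_of_forall_integral_log_le`).

*Mixing distributions.* Normal densities with distinct parameters are linearly independent, so `H`
and `f` have the same mixing distribution (`sum_mul_eq_of_normalMix_eq`). In particular no mass is
lost in the limit, the bivariate distribution functions converge almost everywhere, and the
Kiefer–Wolfowitz distance tends to zero by dominated convergence. As every subsequence of
estimators has a further subsequence with this property, the whole sequence converges.
-/

/-! ### The normal density in terms of mean and standard deviation -/

/-- The density of `N(θ, s²)`, parametrized by the standard deviation `s`. -/
noncomputable def normalPDF (θ s x : ℝ) : ℝ := gaussianPDFReal θ (Real.toNNReal (s ^ 2)) x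

lemma NormalMixing.density_eq {m : ℕ} (G : NormalMixing m) (x : ℝ) :
    G.density x = ∑ j, G.weight j * normalPDF (G.mean j) (G.sd j) x := rfl

lemma normalPDF_eq {s : ℝ} (hs : 0 < s) (θ x : ℝ) :
    normalPDF θ s x = (√(2 * Real.pi))⁻¹ * s⁻¹ * Real.exp (-(x - θ) ^ 2 / (2 * s ^ 2)) := by
  have h2 : (0:ℝ) ≤ s ^ 2 := by positivity
  rw [normalPDF, gaussianPDFReal, Real.coe_toNNReal _ h2, Real.sqrt_mul (by positivity),
    Real.sqrt_sq hs.le, mul_inv]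

lemma normalPDF_nonneg (θ s x : ℝ) : 0 ≤ normalPDF θ s x := gaussianPDFReal_nonneg _ _ _

lemma toNNReal_sq_ne_zero {s : ℝ} (hs : 0 < s) : Real.toNNReal (s ^ 2) ≠ 0 := by
  simpa using hs.ne'

lemma normalPDF_pos {s : ℝ} (hs : 0 < s) (θ x : ℝ) : 0 < normalPDF θ s x :=
  gaussianPDFReal_pos _ _ _ (toNNReal_sq_ne_zero hs)

lemma inv_sqrt_two_pi_le_one : (√(2 * Real.pi))⁻¹ ≤ 1 := by
  apply inv_le_one_of_one_le₀
  rw [Real.one_le_sqrt]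
  nlinarith [Real.pi_gt_three]

lemma normalPDF_le {s : ℝ} (hs : 0 < s) (θ x : ℝ) :
    normalPDF θ s x ≤ s⁻¹ * Real.exp (-(x - θ) ^ 2 / (2 * s ^ 2)) := by
  rw [normalPDF_eq hs, mul_assoc]
  exact mul_le_of_le_one_left (by positivity) inv_sqrt_two_pi_le_one

lemma normalPDF_le_inv {s : ℝ} (hs : 0 < s) (θ x : ℝ) : normalPDF θ s x ≤ s⁻¹ := by
  refine (normalPDF_le hs θ x).trans (mul_le_of_le_one_right (by positivity) ?_)
  rw [Real.exp_le_one_iff, neg_div]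
  exact neg_nonpos.2 (by positivity)

lemma integrable_normalPDF (θ s : ℝ) : Integrable (normalPDF θ s) :=
  integrable_gaussianPDFReal _ _

lemma integral_normalPDF {s : ℝ} (hs : 0 < s) (θ : ℝ) : ∫ x, normalPDF θ s x = 1 :=
  integral_gaussianPDFReal_eq_one _ (toNNReal_sq_ne_zero hs)

lemma abs_exp_neg_sq_div_two_sub_le (a b : ℝ) :
    |Real.exp (-a ^ 2 / 2) - Real.exp (-b ^ 2 / 2)| ≤ |a - b| := by
  have key := Convex.norm_image_sub_le_of_norm_hasDerivWithin_le (𝕜 := ℝ)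
    (f := fun x : ℝ => Real.exp (-x ^ 2 / 2)) (f' := fun x => Real.exp (-x ^ 2 / 2) * (-x))
    (s := Set.univ) (C := 1) (x := b) (y := a) ?_ ?_ convex_univ trivial trivial
  · simpa using key
  · intro x _
    have h : HasDerivAt (fun x : ℝ => -x ^ 2 / 2) (-x) x := by
      convert! ((hasDerivAt_pow 2 x).neg.div_const 2) using 1
      simp
      ring
    exact h.exp.hasDerivWithinAt
  · intro x _
    rw [norm_mul, Real.norm_of_nonneg (Real.exp_pos _).le, norm_neg, Real.norm_eq_abs]
    have h1 : |x| ≤ Real.exp (x ^ 2 / 2) := by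
      have := Real.add_one_le_exp (x ^ 2 / 2)
      nlinarith [sq_nonneg (|x| - 1), sq_abs x]
    have h2 : Real.exp (-x ^ 2 / 2) * Real.exp (x ^ 2 / 2) = 1 := by
      rw [← Real.exp_add]; simp; ring
    calc _ ≤ Real.exp (-x ^ 2 / 2) * Real.exp (x ^ 2 / 2) := by gcongr
      _ = 1 := h2

lemma abs_normalPDF_sub_le {s : ℝ} (hs : 0 < s) (θ x y : ℝ) :
    |normalPDF θ s x - normalPDF θ s y| ≤ (s ^ 2)⁻¹ * |x - y| := by
  have e : ∀ x : ℝ, normalPDF θ s x =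
      (√(2 * Real.pi))⁻¹ * s⁻¹ * Real.exp (-((x - θ) / s) ^ 2 / 2) := by
    intro x
    rw [normalPDF_eq hs]
    congr 2
    field_simp
  rw [e x, e y, ← mul_sub, abs_mul, abs_of_nonneg (by positivity : 0 ≤ (√(2 * Real.pi))⁻¹ * s⁻¹)]
  have h := abs_exp_neg_sq_div_two_sub_le ((x - θ) / s) ((y - θ) / s)
  have h' : |(x - θ) / s - (y - θ) / s| = s⁻¹ * |x - y| := by
    rw [← sub_div, abs_div, abs_of_pos hs]
    ring_nf
  rw [h'] at h
  calc _ ≤ 1 * s⁻¹ * (s⁻¹ * |x - y|) := by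
        gcongr
        exact inv_sqrt_two_pi_le_one
    _ = _ := by ring

lemma continuous_normalPDF {s : ℝ} (hs : 0 < s) (θ : ℝ) : Continuous (normalPDF θ s) := by
  have : normalPDF θ s = fun x =>
    (√(2 * Real.pi))⁻¹ * s⁻¹ * Real.exp (-(x - θ) ^ 2 / (2 * s ^ 2)) := by
    ext x; exact normalPDF_eq hs θ x
  rw [this]
  fun_prop

section Limits

variable {ι : Type*} {l : Filter ι} {θ s : ι → ℝ}

lemma tendsto_normalPDF (hpos : ∀ᶠ i in l, 0 < s i) {t σ : ℝ} (hσ : 0 < σ)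
    (hθ : Tendsto θ l (𝓝 t)) (hs : Tendsto s l (𝓝 σ)) (x : ℝ) :
    Tendsto (fun i => normalPDF (θ i) (s i) x) l (𝓝 (normalPDF t σ x)) := by
  rw [normalPDF_eq hσ]
  refine Tendsto.congr' (f₁ := fun i => (√(2 * Real.pi))⁻¹ * (s i)⁻¹ *
    Real.exp (-(x - θ i) ^ 2 / (2 * (s i) ^ 2))) ?_ ?_
  · filter_upwards [hpos] with i hi
    rw [normalPDF_eq hi]
  · refine (tendsto_const_nhds.mul (hs.inv₀ hσ.ne')).mul ?_
    refine (Real.continuous_exp.tendsto _).comp ?_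
    exact ((tendsto_const_nhds.sub hθ).pow 2).neg.div (tendsto_const_nhds.mul (hs.pow 2))
      (by positivity)

lemma tendsto_normalPDF_zero_of_sd (hpos : ∀ᶠ i in l, 0 < s i) (hs : Tendsto s l atTop) (x : ℝ) :
    Tendsto (fun i => normalPDF (θ i) (s i) x) l (𝓝 0) := by
  refine squeeze_zero' (Eventually.of_forall fun i => normalPDF_nonneg _ _ _) ?_
    (tendsto_inv_atTop_zero.comp hs)
  filter_upwards [hpos] with i hi using normalPDF_le_inv hi _ _

lemma tendsto_normalPDF_zero_of_mean (hpos : ∀ᶠ i in l, 0 < s i) {σ : ℝ} (hσ : 0 < σ)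
    (hθ : Tendsto (fun i => |θ i|) l atTop) (hs : Tendsto s l (𝓝 σ)) (x : ℝ) :
    Tendsto (fun i => normalPDF (θ i) (s i) x) l (𝓝 0) := by
  refine squeeze_zero' (Eventually.of_forall fun i => normalPDF_nonneg _ _ _)
    (g := fun i => (s i)⁻¹ * Real.exp (-((x - θ i) ^ 2 / (2 * s i ^ 2)))) ?_ ?_
  · filter_upwards [hpos] with i hi
    rw [← neg_div]
    exact normalPDF_le hi _ _
  · have h1 : Tendsto (fun i => (x - θ i) ^ 2) l atTop := by
      have : Tendsto (fun i => |x - θ i|) l atTop := by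
        refine tendsto_atTop_mono (f := fun i => |θ i| - |x|) (fun i => ?_)
          (tendsto_atTop_add_const_right _ _ hθ)
        have := abs_sub_abs_le_abs_sub (θ i) x
        rwa [abs_sub_comm] at this
      refine ((tendsto_pow_atTop two_ne_zero).comp this).congr fun i => ?_
      simp
    have h2 : Tendsto (fun i => (2 * s i ^ 2)⁻¹) l (𝓝 (2 * σ ^ 2)⁻¹) :=
      (tendsto_const_nhds.mul (hs.pow 2)).inv₀ (by positivity)
    have h3 : Tendsto (fun i => (x - θ i) ^ 2 / (2 * s i ^ 2)) l atTop := by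
      simp_rw [div_eq_mul_inv]
      exact h1.atTop_mul_pos (by positivity) h2
    simpa using (hs.inv₀ hσ.ne').mul
      (Real.tendsto_exp_atBot.comp (tendsto_neg_atTop_atBot.comp h3))

end Limits

lemma exists_abs_log_le_of_normalPDF_le {s a B : ℝ} (hs : 0 < s) (ha : 0 < a) (θ : ℝ) :
    ∃ C : ℝ, ∀ x H : ℝ, a * normalPDF θ s x ≤ H → H ≤ B → |Real.log H| ≤ C * (1 + x ^ 2) := by
  refine ⟨|Real.log B| + |Real.log (a * ((√(2 * Real.pi))⁻¹ * s⁻¹))| +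
    (1 + θ ^ 2) * (s ^ 2)⁻¹, fun x H h1 h2 => ?_⟩
  have hH : 0 < H := lt_of_lt_of_le (mul_pos ha (normalPDF_pos hs θ x)) h1
  have u : Real.log H ≤ |Real.log B| := (Real.log_le_log hH h2).trans (le_abs_self _)
  have l : Real.log (a * ((√(2 * Real.pi))⁻¹ * s⁻¹)) - (x - θ) ^ 2 / (2 * s ^ 2) ≤
      Real.log H := by
    refine le_trans (le_of_eq ?_) (Real.log_le_log (mul_pos ha (normalPDF_pos hs θ x)) h1)
    have hp : 0 < √(2 * Real.pi) := Real.sqrt_pos.2 (by positivity)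
    rw [normalPDF_eq hs, ← mul_assoc a _ (Real.exp _),
      Real.log_mul (by positivity) (Real.exp_pos _).ne', Real.log_exp]
    ring
  have q : (x - θ) ^ 2 / (2 * s ^ 2) ≤ (1 + θ ^ 2) * (s ^ 2)⁻¹ * (1 + x ^ 2) := by
    rw [div_eq_mul_inv, mul_inv]
    have : (x - θ) ^ 2 * 2⁻¹ ≤ (1 + θ ^ 2) * (1 + x ^ 2) := by
      nlinarith [sq_nonneg (x + θ), mul_nonneg (sq_nonneg x) (sq_nonneg θ)]
    have h0 : 0 ≤ (s ^ 2)⁻¹ := by positivity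
    nlinarith
  have n1 := abs_nonneg (Real.log B)
  have n2 := neg_abs_le (Real.log (a * ((√(2 * Real.pi))⁻¹ * s⁻¹)))
  have n3 := abs_nonneg (Real.log (a * ((√(2 * Real.pi))⁻¹ * s⁻¹)))
  have n4 : 0 ≤ (1 + θ ^ 2) * (s ^ 2)⁻¹ := by positivity
  rw [abs_le]
  constructor <;> nlinarith [sq_nonneg x, mul_nonneg n1 (sq_nonneg x), mul_nonneg n3 (sq_nonneg x),
    mul_nonneg n4 (sq_nonneg x)]

/-! ### The law of the observations -/

/-- A normal mixture with arbitrary coefficients; unlike `NormalMixing.density` it allows the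
coefficients to have a sum smaller than one, as happens when some of the components escape to
infinity. -/
noncomputable def normalMix {m : ℕ} (a θ s : Fin m → ℝ) (x : ℝ) : ℝ :=
  ∑ j, a j * normalPDF (θ j) (s j) x

section NormalMix

variable {m : ℕ} {a θ s : Fin m → ℝ}

lemma normalMix_nonneg (ha : ∀ j, 0 ≤ a j) (x : ℝ) : 0 ≤ normalMix a θ s x :=
  Finset.sum_nonneg fun j _ => mul_nonneg (ha j) (normalPDF_nonneg _ _ _)

lemma normalMix_le {c : ℝ} (hc : 0 < c) (ha : ∀ j, 0 ≤ a j) (ha1 : ∑ j, a j ≤ 1)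
    (hs : ∀ j, a j = 0 ∨ c ≤ s j) (x : ℝ) : normalMix a θ s x ≤ c⁻¹ := by
  calc normalMix a θ s x ≤ ∑ j, a j * c⁻¹ := by
        refine Finset.sum_le_sum fun j _ => ?_
        rcases hs j with h | h
        · simp [h]
        · refine mul_le_mul_of_nonneg_left ?_ (ha j)
          exact (normalPDF_le_inv (hc.trans_le h) _ _).trans (inv_anti₀ hc h)
    _ = (∑ j, a j) * c⁻¹ := by rw [Finset.sum_mul]
    _ ≤ 1 * c⁻¹ := by gcongr
    _ = c⁻¹ := one_mul _

lemma abs_normalMix_sub_le {c : ℝ} (hc : 0 < c) (ha : ∀ j, 0 ≤ a j) (ha1 : ∑ j, a j ≤ 1)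
    (hs : ∀ j, a j = 0 ∨ c ≤ s j) (x y : ℝ) :
    |normalMix a θ s x - normalMix a θ s y| ≤ (c ^ 2)⁻¹ * |x - y| := by
  rw [normalMix, normalMix, ← Finset.sum_sub_distrib]
  calc _ ≤ ∑ j, |a j * normalPDF (θ j) (s j) x - a j * normalPDF (θ j) (s j) y| :=
        Finset.abs_sum_le_sum_abs _ _
    _ ≤ ∑ j, a j * ((c ^ 2)⁻¹ * |x - y|) := by
        refine Finset.sum_le_sum fun j _ => ?_
        rw [← mul_sub, abs_mul, abs_of_nonneg (ha j)]
        rcases hs j with h | h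
        · simp [h]
        · refine mul_le_mul_of_nonneg_left ?_ (ha j)
          refine (abs_normalPDF_sub_le (hc.trans_le h) _ _ _).trans ?_
          gcongr
    _ = (∑ j, a j) * ((c ^ 2)⁻¹ * |x - y|) := by rw [Finset.sum_mul]
    _ ≤ 1 * ((c ^ 2)⁻¹ * |x - y|) := by gcongr
    _ = _ := one_mul _

lemma continuous_normalMix (hs : ∀ j, 0 < s j) : Continuous (normalMix a θ s) :=
  continuous_finsetSum _ fun j _ => continuous_const.mul (continuous_normalPDF (hs j) _)

lemma integrable_normalMix : Integrable (normalMix a θ s) :=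
  integrable_finsetSum _ fun _ _ => (integrable_normalPDF _ _).const_mul _

lemma integral_normalMix (hs : ∀ j, 0 < s j) : ∫ x, normalMix a θ s x = ∑ j, a j := by
  unfold normalMix
  rw [integral_finsetSum _ fun j _ => (integrable_normalPDF _ _).const_mul _]
  simp [integral_const_mul, integral_normalPDF (hs _)]

lemma exists_abs_log_normalMix_le {B : ℝ} (ha : ∀ j, 0 ≤ a j) (hs : ∀ j, 0 < s j)
    {j : Fin m} (hj : 0 < a j) :
    ∃ C : ℝ, ∀ x H, normalMix a θ s x ≤ H → H ≤ B → |Real.log H| ≤ C * (1 + x ^ 2) := by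
  obtain ⟨C, hC⟩ := exists_abs_log_le_of_normalPDF_le (B := B) (hs j) hj (θ j)
  refine ⟨C, fun x H h1 h2 => hC x H (le_trans ?_ h1) h2⟩
  exact Finset.single_le_sum (f := fun j => a j * normalPDF (θ j) (s j) x)
    (fun j _ => mul_nonneg (ha j) (normalPDF_nonneg _ _ _)) (Finset.mem_univ j)

end NormalMix

namespace NormalMixing

variable {m : ℕ} (G : NormalMixing m)

lemma density_eq_normalMix : G.density = normalMix G.weight G.mean G.sd := rfl

lemma exists_weight_pos : ∃ j, 0 < G.weight j := by
  by_contra! h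
  have := G.weight_sum
  have h2 : ∑ j, G.weight j ≤ 0 := Finset.sum_nonpos fun j _ => h j
  linarith

lemma exists_sd_lower_bound : ∃ c, 0 < c ∧ ∀ j, c ≤ G.sd j := by
  obtain ⟨j0, -⟩ := G.exists_weight_pos
  obtain ⟨j1, -, h⟩ := Finset.exists_min_image Finset.univ G.sd ⟨j0, Finset.mem_univ _⟩
  exact ⟨G.sd j1, G.sd_pos _, fun j => h j (Finset.mem_univ _)⟩

lemma exists_density_le : ∃ M, 0 < M ∧ ∀ x, G.density x ≤ M := by
  obtain ⟨c, hc, h⟩ := G.exists_sd_lower_bound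
  exact ⟨c⁻¹, by positivity, fun x =>
    normalMix_le hc G.weight_nonneg G.weight_sum.le (fun j => Or.inr (h j)) x⟩

lemma density_pos (x : ℝ) : 0 < G.density x := by
  obtain ⟨j, hj⟩ := G.exists_weight_pos
  exact Finset.sum_pos' (fun j _ => mul_nonneg (G.weight_nonneg j) (normalPDF_nonneg _ _ _))
    ⟨j, Finset.mem_univ _, mul_pos hj (normalPDF_pos (G.sd_pos j) _ _)⟩

lemma continuous_density : Continuous G.density := continuous_normalMix G.sd_pos

lemma measurable_density : Measurable G.density := G.continuous_density.measurable

lemma integrable_law_iff {g : ℝ → ℝ} :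
    Integrable g G.law ↔ Integrable (fun x => g x * G.density x) := by
  rw [law, integrable_withDensity_iff (G.measurable_density.ennreal_ofReal) (by simp)]
  simp [ENNReal.toReal_ofReal (G.density_pos _).le]

lemma integral_law (g : ℝ → ℝ) : ∫ x, g x ∂G.law = ∫ x, G.density x * g x := by
  rw [law, integral_withDensity_eq_integral_toReal_smul G.measurable_density.ennreal_ofReal
    (by simp)]
  simp [ENNReal.toReal_ofReal (G.density_pos _).le]

instance : IsProbabilityMeasure G.law := by
  constructor
  rw [law, withDensity_apply _ MeasurableSet.univ, Measure.restrict_univ,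
    ← ofReal_integral_eq_lintegral_ofReal, density_eq_normalMix, integral_normalMix G.sd_pos,
    G.weight_sum, ENNReal.ofReal_one]
  · exact integrable_normalMix
  · exact Eventually.of_forall fun x => (G.density_pos x).le

lemma law_le {M : ℝ} (hM : ∀ x, G.density x ≤ M) (s : Set ℝ) :
    G.law s ≤ ENNReal.ofReal M * volume s := by
  have : G.law ≤ (ENNReal.ofReal M) • (volume : Measure ℝ) := by
    rw [law, ← withDensity_const]
    exact withDensity_mono (Eventually.of_forall fun x => ENNReal.ofReal_le_ofReal (hM x))
  exact this s

lemma ae_volume_of_ae_law {p : ℝ → Prop} (h : ∀ᵐ x ∂G.law, p x) : ∀ᵐ x, p x := by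
  rw [law, ae_withDensity_iff G.measurable_density.ennreal_ofReal] at h
  filter_upwards [h] with x hx
  exact hx (by simpa using G.density_pos x)

lemma integrable_one_add_sq_law : Integrable (fun x : ℝ => 1 + x ^ 2) G.law := by
  rw [integrable_law_iff]
  simp only [density_eq, Finset.mul_sum]
  refine integrable_finsetSum _ fun j _ => ?_
  have h1 : Integrable (fun x : ℝ => 1 + x ^ 2)
      (gaussianReal (G.mean j) (Real.toNNReal (G.sd j ^ 2))) :=
    (integrable_const _).add ((memLp_id_gaussianReal 2).integrable_sq)
  rw [gaussianReal_of_var_ne_zero _ (toNNReal_sq_ne_zero (G.sd_pos j)),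
    integrable_withDensity_iff (measurable_gaussianPDF _ _) (by simp [gaussianPDF_lt_top])] at h1
  simp only [toReal_gaussianPDF] at h1
  refine (h1.const_mul (G.weight j)).congr (Eventually.of_forall fun x => ?_)
  simp only [normalPDF]
  ring

lemma integrable_log_density : Integrable (fun x => Real.log (G.density x)) G.law := by
  obtain ⟨j, hj⟩ := G.exists_weight_pos
  obtain ⟨M, -, hM⟩ := G.exists_density_le
  obtain ⟨C, hC⟩ := exists_abs_log_normalMix_le (B := M) (θ := G.mean) G.weight_nonneg G.sd_pos hj
  refine (G.integrable_one_add_sq_law.const_mul C).mono'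
    G.measurable_density.log.aestronglyMeasurable (Eventually.of_forall fun x => ?_)
  exact hC x _ le_rfl (hM x)

end NormalMixing

/-! ### Uniform bounds for the number of observations in short intervals -/

open scoped Classical in
/-- The number of observations among `x 0, …, x (n - 1)` that fall into `s`. -/
noncomputable def obsCount (x : ℕ → ℝ) (n : ℕ) (s : Set ℝ) : ℕ :=
  ((Finset.range n).filter fun i => x i ∈ s).card

/-- The `k`-th cell of the partition of the line into half-open intervals of length `h`. -/
def cell (h : ℝ) (k : ℤ) : Set ℝ := {x | ⌊x / h⌋ = k}

lemma measurableSet_cell (h : ℝ) (k : ℤ) : MeasurableSet (cell h k) :=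
  (Int.measurable_floor.comp (measurable_id.div_const h)) (measurableSet_singleton k)

lemma cell_subset_Ico {h : ℝ} (hh : 0 < h) (k : ℤ) : cell h k ⊆ Set.Ico (k * h) (k * h + h) := by
  intro x hx
  have := Int.floor_eq_iff.1 (show ⌊x / h⌋ = k from hx)
  rw [le_div_iff₀ hh, div_lt_iff₀ hh] at this
  exact ⟨this.1, by linarith [this.2]⟩

lemma volume_cell_le {h : ℝ} (hh : 0 < h) (k : ℤ) : volume (cell h k) ≤ ENNReal.ofReal h := by
  refine (measure_mono (cell_subset_Ico hh k)).trans ?_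
  rw [Real.volume_Ico]
  simp

lemma tsum_measure_cell (ν : Measure ℝ) [IsProbabilityMeasure ν] (h : ℝ) :
    ∑' k, ν (cell h k) = 1 := by
  rw [← measure_iUnion _ (measurableSet_cell h)]
  · rw [show (⋃ k, cell h k) = Set.univ from ?_, measure_univ]
    ext x
    simp [cell]
  · intro i j hij
    refine Set.disjoint_left.2 fun x hi hj => hij ?_
    exact (show ⌊x / h⌋ = i from hi).symm.trans hj

section Counts

variable {Ω : Type*} [MeasurableSpace Ω] {P : Measure Ω}
  {X : ℕ → Ω → ℝ} {ν : Measure ℝ}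

lemma measure_le_obsCount_le (hX : ∀ i, Measurable (X i)) (hind : iIndepFun X P)
    (hlaw : ∀ i, P.map (X i) = ν) {s : Set ℝ} (hs : MeasurableSet s) (n a : ℕ) :
    P {ω | a ≤ obsCount (fun i => X i ω) n s} ≤ n.choose a * ν s ^ a := by
  classical
  have hsub : {ω | a ≤ obsCount (fun i => X i ω) n s} ⊆
      ⋃ T ∈ (Finset.range n).powersetCard a, ⋂ i ∈ T, X i ⁻¹' s := by
    intro ω hω
    obtain ⟨T, hT, hcard⟩ := Finset.exists_subset_card_eq (show a ≤ _ from hω)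
    simp only [Set.mem_iUnion, Set.mem_iInter, Finset.mem_powersetCard]
    refine ⟨T, ⟨fun i hi => (Finset.mem_filter.1 (hT hi)).1, hcard⟩, fun i hi => ?_⟩
    exact (Finset.mem_filter.1 (hT hi)).2
  refine (measure_mono hsub).trans ((measure_biUnion_finset_le _ _).trans ?_)
  have : ∀ T ∈ (Finset.range n).powersetCard a, P (⋂ i ∈ T, X i ⁻¹' s) = ν s ^ a := by
    intro T hT
    rw [hind.measure_inter_preimage_eq_mul T (sets := fun _ => s) (fun _ _ => hs)]
    have : ∀ i, P (X i ⁻¹' s) = ν s := fun i => by rw [← hlaw i, Measure.map_apply (hX i) hs]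
    simp [this, (Finset.mem_powersetCard.1 hT).2]
  rw [Finset.sum_congr rfl this]
  simp

lemma measure_exists_le_obsCount_cell_le (hX : ∀ i, Measurable (X i)) (hind : iIndepFun X P)
    (hlaw : ∀ i, P.map (X i) = ν) [IsProbabilityMeasure ν] {M h : ℝ} (hM0 : 0 ≤ M)
    (hM : ∀ s, ν s ≤ ENNReal.ofReal M * volume s)
    (hh : 0 < h) (n a : ℕ) :
    P {ω | ∃ k, a + 1 ≤ obsCount (fun i => X i ω) n (cell h k)} ≤
      n.choose (a + 1) * ENNReal.ofReal (M * h) ^ a := by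
  rw [Set.ofPred_exists]
  calc _ ≤ ∑' k, P {ω | a + 1 ≤ obsCount (fun i => X i ω) n (cell h k)} := measure_iUnion_le _
    _ ≤ ∑' k, n.choose (a + 1) * ENNReal.ofReal (M * h) ^ a * ν (cell h k) := by
        refine ENNReal.tsum_le_tsum fun k => ?_
        refine (measure_le_obsCount_le hX hind hlaw (measurableSet_cell h k) n (a + 1)).trans ?_
        rw [pow_succ, ← mul_assoc]
        gcongr
        refine (hM _).trans ?_
        rw [ENNReal.ofReal_mul hM0]
        gcongr
        exact volume_cell_le hh k
    _ = _ := by rw [ENNReal.tsum_mul_left, tsum_measure_cell, mul_one]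

/-- Cells of length `L / n` have `M L` expected observations at most, so that more than a large
multiple `K L` of them is exponentially unlikely in `L`. -/
lemma choose_mul_pow_le {n L K : ℕ} {M : ℝ} (hn : 1 ≤ n) (hL : 1 ≤ L) (hM : 1 ≤ M)
    (hK : 4 * M + 2 ≤ K) (hLn : Real.log n ≤ L) :
    (n.choose (K * L) : ℝ) * (M * (L / n)) ^ (K * L - 1) ≤ ((n : ℝ) ^ 2)⁻¹ := by
  have hn0 : (0:ℝ) < n := by exact_mod_cast hn
  have hL0 : (1:ℝ) ≤ L := by exact_mod_cast hL
  have hK1 : 1 ≤ K := by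
    have : (1:ℝ) ≤ K := by linarith
    exact_mod_cast this
  obtain ⟨b, hb⟩ : ∃ b, K * L = b + 1 := ⟨K * L - 1, by have := Nat.mul_pos hK1 hL; omega⟩
  have hbR : (K : ℝ) * L = (b + 1 : ℕ) := by rw [← hb]; push_cast; rfl
  rw [hb, Nat.add_sub_cancel]
  have h1 : (n.choose (b + 1) : ℝ) ≤ n ^ (b + 1) / (b + 1).factorial :=
    Nat.choose_le_pow_div _ _
  have h2 := Real.pow_div_factorial_le_exp (x := 8 * (M * L)) (by positivity) (b + 1)
  have h8 : Real.exp 2 ≤ 8 := by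
    have := Real.exp_one_lt_d9
    rw [show (2:ℝ) = 1 + 1 by norm_num, Real.exp_add]
    nlinarith [Real.exp_pos 1]
  have hML : 1 ≤ M * L := by nlinarith
  have h3 : (M * L) ^ (b + 1) / (b + 1).factorial ≤ Real.exp (-3 * L) := by
    have e8 : Real.exp (2 * (K * L)) ≤ 8 ^ (b + 1) := by
      rw [hbR, mul_comm, Real.exp_nat_mul]
      gcongr
    have : (M * L) ^ (b + 1) / (b + 1).factorial * 8 ^ (b + 1) ≤ Real.exp (8 * (M * L)) := by
      rw [mul_pow] at h2
      calc _ = 8 ^ (b + 1) * (M * L) ^ (b + 1) / (b + 1).factorial := by ring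
        _ ≤ _ := h2
    have h4 : (M * L) ^ (b + 1) / (b + 1).factorial * Real.exp (2 * (K * L)) ≤
        Real.exp (8 * (M * L)) := le_trans (by gcongr) this
    rw [← le_div_iff₀ (Real.exp_pos _), ← Real.exp_sub] at h4
    refine h4.trans (Real.exp_le_exp.2 ?_)
    nlinarith
  have h5 : Real.exp (-3 * L) ≤ ((n : ℝ) ^ 3)⁻¹ := by
    rw [neg_mul, Real.exp_neg]
    refine inv_anti₀ (by positivity) ?_
    have := Real.exp_le_exp.2 hLn
    rw [Real.exp_log hn0] at this
    calc (n:ℝ) ^ 3 ≤ Real.exp L ^ 3 := by gcongr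
      _ = Real.exp (3 * L) := by rw [← Real.exp_nat_mul]; norm_num
  calc (n.choose (b + 1) : ℝ) * (M * (L / n)) ^ b
      ≤ n ^ (b + 1) / (b + 1).factorial * (M * (L / n)) ^ b := by gcongr
    _ = n * ((M * L) ^ b / (b + 1).factorial) := by
        rw [← mul_div_assoc, div_pow]
        field_simp
        ring
    _ ≤ n * ((M * L) ^ (b + 1) / (b + 1).factorial) := by
        gcongr ?_ * (?_ / _)
        exact pow_le_pow_right₀ hML (Nat.le_succ b)
    _ ≤ n * ((n : ℝ) ^ 3)⁻¹ := by
        gcongr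
        exact h3.trans h5
    _ = ((n : ℝ) ^ 2)⁻¹ := by field_simp

lemma ae_eventually_obsCount_cell_lt (hX : ∀ i, Measurable (X i)) (hind : iIndepFun X P)
    (hlaw : ∀ i, P.map (X i) = ν) [IsProbabilityMeasure ν] {M : ℝ} (hM1 : 1 ≤ M)
    (hM : ∀ s, ν s ≤ ENNReal.ofReal M * volume s) {K : ℕ} (hK : 4 * M + 2 ≤ K) :
    ∀ᵐ ω ∂P, ∀ᶠ n : ℕ in atTop, ∀ k,
      obsCount (fun i => X i ω) n (cell (⌈Real.log n⌉₊ / n) k) < K * ⌈Real.log n⌉₊ := by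
  set A : ℕ → Set Ω := fun n => {ω | 2 ≤ n ∧ ∃ k, K * ⌈Real.log n⌉₊ ≤
    obsCount (fun i => X i ω) n (cell (⌈Real.log n⌉₊ / n) k)} with hA
  have hbound : ∀ n, P (A n) ≤ ENNReal.ofReal (((n : ℝ) ^ 2)⁻¹) := by
    intro n
    by_cases hn : 2 ≤ n
    · have hL : 1 ≤ ⌈Real.log n⌉₊ := Nat.one_le_ceil_iff.2 (Real.log_pos (by exact_mod_cast hn))
      have hn0 : (0:ℝ) < n := by positivity
      have hh : (0:ℝ) < ⌈Real.log n⌉₊ / n := by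
        have : (0:ℝ) < ⌈Real.log n⌉₊ := by exact_mod_cast hL
        positivity
      have hK1 : 1 ≤ K := by
        have : (1:ℝ) ≤ K := by linarith
        exact_mod_cast this
      have h1 := measure_exists_le_obsCount_cell_le hX hind hlaw (by linarith) hM hh n
        (K * ⌈Real.log n⌉₊ - 1)
      rw [Nat.sub_add_cancel (Nat.mul_pos hK1 hL)] at h1
      refine (measure_mono fun ω hω => hω.2).trans (h1.trans ?_)
      rw [← ENNReal.ofReal_pow (by positivity), ← ENNReal.ofReal_natCast,
        ← ENNReal.ofReal_mul (by positivity)]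
      exact ENNReal.ofReal_le_ofReal (choose_mul_pow_le (by omega) hL hM1 hK (Nat.le_ceil _))
    · simp [hA, hn]
  have hsum : ∑' n, P (A n) ≠ ∞ := by
    refine ne_top_of_le_ne_top ?_ (ENNReal.tsum_le_tsum hbound)
    rw [← ENNReal.ofReal_tsum_of_nonneg (fun n => by positivity)
      (Real.summable_nat_pow_inv.2 one_lt_two)]
    exact ENNReal.ofReal_ne_top
  filter_upwards [ae_eventually_notMem hsum] with ω hω
  filter_upwards [hω, eventually_ge_atTop 2] with n hn h2 k
  by_contra! hk
  exact hn ⟨h2, k, hk⟩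

lemma obsCount_closedBall_le {x : ℕ → ℝ} {n a : ℕ} {h θ r : ℝ} (hh : 0 < h) (hr : 0 ≤ r)
    (hx : ∀ k, obsCount x n (cell h k) ≤ a) :
    (obsCount x n (Metric.closedBall θ r) : ℝ) ≤ (2 * r / h + 2) * a := by
  classical
  set I := Finset.Icc ⌊(θ - r) / h⌋ ⌊(θ + r) / h⌋ with hI
  have h1 : obsCount x n (Metric.closedBall θ r) ≤ ∑ k ∈ I, obsCount x n (cell h k) := by
    refine le_trans (Finset.card_le_card fun i hi => ?_) Finset.card_biUnion_le
    obtain ⟨hi1, hi2⟩ := Finset.mem_filter.1 hi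
    rw [Metric.mem_closedBall, Real.dist_eq, abs_le] at hi2
    refine Finset.mem_biUnion.2 ⟨⌊x i / h⌋, Finset.mem_Icc.2 ⟨?_, ?_⟩,
      Finset.mem_filter.2 ⟨hi1, rfl⟩⟩
    · exact Int.floor_le_floor (by gcongr; linarith)
    · exact Int.floor_le_floor (by gcongr; linarith)
  have h2 : ((I.card : ℕ) : ℝ) ≤ 2 * r / h + 2 := by
    have hle : ⌊(θ - r) / h⌋ ≤ ⌊(θ + r) / h⌋ := Int.floor_le_floor (by gcongr; linarith)
    have : ((I.card : ℕ) : ℤ) = ⌊(θ + r) / h⌋ + 1 - ⌊(θ - r) / h⌋ := by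
      rw [hI, Int.card_Icc, Int.toNat_of_nonneg (by omega)]
    have h3 : ((I.card : ℕ) : ℝ) = ⌊(θ + r) / h⌋ + 1 - ⌊(θ - r) / h⌋ := by exact_mod_cast this
    have h4 := Int.floor_le ((θ + r) / h)
    have h5 := Int.lt_floor_add_one ((θ - r) / h)
    have h6 : 2 * r / h = (θ + r) / h - (θ - r) / h := by ring
    linarith
  calc (obsCount x n (Metric.closedBall θ r) : ℝ) ≤ ((∑ k ∈ I, a : ℕ) : ℝ) := by
        exact_mod_cast h1.trans (Finset.sum_le_sum fun k _ => hx k)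
    _ = I.card * a := by simp
    _ ≤ _ := by gcongr

/-- Almost surely, eventually every interval of length `2 r` contains at most a constant times
`n r + log n` observations, simultaneously for all intervals. -/
theorem ae_exists_obsCount_closedBall_le (hX : ∀ i, Measurable (X i)) (hind : iIndepFun X P)
    (hlaw : ∀ i, P.map (X i) = ν) [IsProbabilityMeasure ν] {M : ℝ}
    (hM : ∀ s, ν s ≤ ENNReal.ofReal M * volume s) :
    ∃ C : ℝ, 0 < C ∧ ∀ᵐ ω ∂P, ∀ᶠ n : ℕ in atTop, ∀ θ r : ℝ, 0 ≤ r →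
      (obsCount (fun i => X i ω) n (Metric.closedBall θ r) : ℝ) ≤ C * (n * r + Real.log n) := by
  obtain ⟨K, hK⟩ := exists_nat_ge (4 * max M 1 + 2)
  have hK0 : (0:ℝ) < K := by linarith [le_max_right M 1]
  have hM' : ∀ s, ν s ≤ ENNReal.ofReal (max M 1) * volume s := fun s => (hM s).trans (by
    gcongr
    exact le_max_left _ _)
  refine ⟨4 * K, by positivity, ?_⟩
  filter_upwards [ae_eventually_obsCount_cell_lt hX hind hlaw (le_max_right M 1) hM' hK] with ω hω
  filter_upwards [hω, eventually_ge_atTop 3] with n hn h3 θ r hr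
  have hlog : 1 ≤ Real.log n := by
    rw [Real.le_log_iff_exp_le (by positivity)]
    have : (3:ℝ) ≤ n := by exact_mod_cast h3
    linarith [Real.exp_one_lt_d9]
  have hceil := (Nat.ceil_lt_add_one (zero_le_one.trans hlog)).le
  have hL0 : (0:ℝ) < ⌈Real.log n⌉₊ := lt_of_lt_of_le (by linarith) (Nat.le_ceil _)
  have hn0 : (0:ℝ) < n := by positivity
  refine (obsCount_closedBall_le (θ := θ) (div_pos hL0 hn0) hr fun k => (hn k).le).trans ?_
  rw [div_div_eq_mul_div, Nat.cast_mul]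
  have : (2 * r * n / (⌈Real.log n⌉₊ : ℝ) + 2) * (K * ⌈Real.log n⌉₊) =
      K * (2 * (n * r) + 2 * ⌈Real.log n⌉₊) := by field_simp
  rw [this, mul_comm (4:ℝ), mul_assoc]
  gcongr
  have : 0 ≤ n * r := by positivity
  linarith

end Counts

/-! ### Components with a small standard deviation -/

/-- With `u = -log σ`, the density `φ(·; θ, σ²)` is at most `1 / σ = exp u` everywhere and at most
`exp (u - u² / 2)` outside the window of radius `σ u` around `θ`. -/
lemma log_one_add_normalPDF_div_le {ε u : ℝ} (hε : 0 < ε) (hu : 0 ≤ u)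
    (huε : Real.log (1 + ε⁻¹) ≤ u) (θ x : ℝ)
    [Decidable (x ∈ Metric.closedBall θ (Real.exp (-u) * u))] :
    Real.log (1 + normalPDF θ (Real.exp (-u)) x / ε) ≤
      (if x ∈ Metric.closedBall θ (Real.exp (-u) * u) then 2 * u else 0) +
        Real.exp (u - u ^ 2 / 2) / ε := by
  have hφ := normalPDF_nonneg θ (Real.exp (-u)) x
  split_ifs with h
  · have h1 : normalPDF θ (Real.exp (-u)) x ≤ Real.exp u := by
      simpa [Real.exp_neg] using normalPDF_le_inv (Real.exp_pos (-u)) θ x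
    have h2 : 1 + normalPDF θ (Real.exp (-u)) x / ε ≤ Real.exp u * (1 + ε⁻¹) := by
      have : normalPDF θ (Real.exp (-u)) x / ε ≤ Real.exp u * ε⁻¹ := by
        rw [div_eq_mul_inv]; gcongr
      linarith [Real.one_le_exp hu]
    have h3 := Real.log_le_log (by positivity) h2
    rw [Real.log_mul (Real.exp_pos _).ne' (by positivity), Real.log_exp] at h3
    have : 0 ≤ Real.exp (u - u ^ 2 / 2) / ε := by positivity
    linarith
  · rw [Metric.mem_closedBall, Real.dist_eq, not_le] at h
    rw [zero_add]
    refine (Real.log_le_sub_one_of_pos (by positivity)).trans ?_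
    rw [add_sub_cancel_left]
    gcongr
    refine (normalPDF_le (Real.exp_pos _) θ x).trans ?_
    rw [← Real.exp_neg, neg_neg, ← Real.exp_add]
    refine Real.exp_le_exp.2 ?_
    have hsq : (Real.exp (-u) * u) ^ 2 ≤ (x - θ) ^ 2 := by
      rw [← sq_abs (x - θ)]
      gcongr
    have : u ^ 2 / 2 ≤ (x - θ) ^ 2 / (2 * Real.exp (-u) ^ 2) := by
      rw [le_div_iff₀ (by positivity)]
      calc _ = (Real.exp (-u) * u) ^ 2 := by ring
        _ ≤ _ := hsq
    rw [neg_div]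
    linarith

lemma sum_log_one_add_normalPDF_div_le {ε u : ℝ} (hε : 0 < ε) (hu : 0 ≤ u)
    (huε : Real.log (1 + ε⁻¹) ≤ u) (θ : ℝ) (x : ℕ → ℝ) (n : ℕ) :
    ∑ i ∈ Finset.range n, Real.log (1 + normalPDF θ (Real.exp (-u)) (x i) / ε) ≤
      obsCount x n (Metric.closedBall θ (Real.exp (-u) * u)) * (2 * u) +
        n * (Real.exp (u - u ^ 2 / 2) / ε) := by
  classical
  refine (Finset.sum_le_sum fun i _ =>
    log_one_add_normalPDF_div_le hε hu huε θ (x i)).trans (le_of_eq ?_)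
  rw [Finset.sum_add_distrib, ← Finset.sum_filter]
  simp only [Finset.sum_const, nsmul_eq_mul, Finset.card_range, obsCount]

lemma tendsto_exp_sub_sq_div_two : Tendsto (fun u : ℝ => Real.exp (u - u ^ 2 / 2)) atTop (𝓝 0) := by
  refine Real.tendsto_exp_atBot.comp ?_
  have : (fun u : ℝ => u - u ^ 2 / 2) = fun u => u * (1 - u / 2) := by ext; ring
  rw [this]
  refine tendsto_id.atTop_mul_atBot₀ ?_
  have h : Tendsto (fun u : ℝ => u / 2) atTop atTop := tendsto_id.atTop_div_const two_pos
  simpa [sub_eq_add_neg] using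
    tendsto_atBot_add_const_left _ (1:ℝ) (tendsto_neg_atTop_atBot.comp h)

/-- The likelihood gained from a component with a small standard deviation `σ` is compensated by
the penalty. For `σ ≥ log n / n` few enough observations are close to the mean; for smaller `σ`,
the gain `O(log n) |log σ|` is outweighed by the penalty `(log n)² log σ`. -/
theorem exists_sd_bound {x : ℕ → ℝ} {C : ℝ} (hC : 0 < C)
    (hx : ∀ᶠ n : ℕ in atTop, ∀ θ r : ℝ, 0 ≤ r →
      (obsCount x n (Metric.closedBall θ r) : ℝ) ≤ C * (n * r + Real.log n))
    {q : ℕ → ℝ → ℝ} (hq2 : PenaltyModerate q) (hq3 : PenaltySevere q) {ε δ : ℝ}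
    (hε : 0 < ε) (hδ : 0 < δ) :
    ∃ σ₀ > 0, ∀ᶠ n : ℕ in atTop, ∀ θ σ, 0 < σ → σ < σ₀ →
      ∑ i ∈ Finset.range n, Real.log (1 + normalPDF θ σ (x i) / ε) + q n σ ≤ δ * n := by
  have hδ4 : 0 < δ / 4 := by positivity
  have hu1 : ∀ᶠ u : ℝ in atTop, 2 * C * (u ^ 2 * Real.exp (-u)) ≤ δ / 4 := by
    have := (Real.tendsto_pow_mul_exp_neg_atTop_nhds_zero 2).const_mul (2 * C)
    rw [mul_zero] at this
    exact this.eventually_le_const hδ4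
  have hu2 : ∀ᶠ u : ℝ in atTop, Real.exp (u - u ^ 2 / 2) / ε ≤ δ / 4 := by
    have := tendsto_exp_sub_sq_div_two.div_const ε
    rw [zero_div] at this
    exact this.eventually_le_const hδ4
  obtain ⟨u₀, hu₀⟩ := eventually_atTop.1
    (hu1.and (hu2.and ((eventually_ge_atTop 0).and (eventually_ge_atTop (Real.log (1 + ε⁻¹))))))
  refine ⟨Real.exp (-u₀), Real.exp_pos _, ?_⟩
  have hlog : Tendsto (fun n : ℕ => Real.log n) atTop atTop :=
    Real.tendsto_log_atTop.comp tendsto_natCast_atTop_atTop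
  have hlogn : ∀ᶠ n : ℕ in atTop, 2 * C * Real.log n ^ 2 ≤ δ / 4 * n := by
    have h1 := ((Real.isLittleO_pow_log_id_atTop (n := 2)).comp_tendsto
      tendsto_natCast_atTop_atTop).def (c := δ / 4 / (2 * C)) (by positivity)
    filter_upwards [h1] with n hn
    simp only [Function.comp, id, Real.norm_eq_abs, Nat.abs_cast, abs_pow, sq_abs] at hn
    rw [div_mul_eq_mul_div, le_div_iff₀ (by positivity)] at hn
    linarith
  filter_upwards [hx, hq2.1 (δ / 4) hδ4, hq3, hlogn, hlog.eventually_ge_atTop 1,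
    hlog.eventually_ge_atTop (2 * C), eventually_gt_atTop 0] with n hxn hq2n hq3n hln hl1 hlC hn0
    θ σ hσ0 hσ
  obtain ⟨u, rfl⟩ : ∃ u, σ = Real.exp (-u) := ⟨-Real.log σ, by rw [neg_neg, Real.exp_log hσ0]⟩
  obtain ⟨a1, a2, a3, a4⟩ := hu₀ u (by linarith [Real.exp_lt_exp.1 hσ])
  have hn : (0:ℝ) < n := by exact_mod_cast hn0
  have h1 := sum_log_one_add_normalPDF_div_le hε a3 a4 θ x n
  have h2 := mul_le_mul_of_nonneg_right (hxn θ (Real.exp (-u) * u) (by positivity))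
    (by positivity : 0 ≤ 2 * u)
  have h3 : C * (n * (Real.exp (-u) * u) + Real.log n) * (2 * u) ≤
      δ / 4 * n + 2 * C * Real.log n * u := by
    have := mul_le_mul_of_nonneg_right a1 hn.le
    nlinarith
  have h4 : (n:ℝ) * (Real.exp (u - u ^ 2 / 2) / ε) ≤ δ / 4 * n := by
    rw [mul_comm]; gcongr
  have h5 : 2 * C * Real.log n * u + q n (Real.exp (-u)) ≤ δ / 4 * n + δ / 4 * n := by
    have hq := (le_max_left _ _).trans (hq2n _ hσ0)
    by_cases hcase : Real.exp (-u) < (n:ℝ)⁻¹ * Real.log n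
    · have := hq3n _ hσ0 hcase
      rw [Real.log_exp] at this
      have h6 : 2 * C * Real.log n * u ≤ Real.log n * Real.log n * u := by gcongr
      have : 0 ≤ δ / 4 * n := by positivity
      nlinarith
    · have hu : u ≤ Real.log n := by
        have h6 : (n:ℝ)⁻¹ ≤ Real.exp (-u) :=
          le_trans (le_mul_of_one_le_right (by positivity) hl1) (not_lt.1 hcase)
        have := Real.log_le_log (by positivity) h6
        rw [Real.log_exp, Real.log_inv] at this
        linarith
      have : 2 * C * Real.log n * u ≤ 2 * C * Real.log n * Real.log n := by gcongr
      nlinarith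
  linarith

/-! ### A uniform law of large numbers -/

lemma ae_tendsto_average {Ω : Type*} [MeasurableSpace Ω] {P : Measure Ω} {X : ℕ → Ω → ℝ}
    {ν : Measure ℝ} (hX : ∀ i, Measurable (X i)) (hind : iIndepFun X P)
    (hlaw : ∀ i, P.map (X i) = ν) {g : ℝ → ℝ} (hg : Measurable g) (hint : Integrable g ν) :
    ∀ᵐ ω ∂P, Tendsto (fun n : ℕ => (∑ i ∈ Finset.range n, g (X i ω)) / n) atTop
      (𝓝 (∫ x, g x ∂ν)) := by
  have h := strong_law_ae_real (μ := P) (fun i ω => g (X i ω)) ?_ ?_ ?_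
  · have e : ∫ ω, g (X 0 ω) ∂P = ∫ x, g x ∂ν := by
      rw [← hlaw 0, integral_map (hX 0).aemeasurable hg.aestronglyMeasurable]
    rw [← e]
    exact h
  · rw [← hlaw 0] at hint
    exact hint.comp_measurable (hX 0)
  · intro i j hij
    exact (hind.indepFun hij).comp hg hg
  · intro i
    exact (IdentDistrib.mk (hX i).aemeasurable (hX 0).aemeasurable
      ((hlaw i).trans (hlaw 0).symm)).comp hg

lemma obsCount_eq_sum (x : ℕ → ℝ) (n : ℕ) (s : Set ℝ) :
    (obsCount x n s : ℝ) = ∑ i ∈ Finset.range n, s.indicator (fun _ => (1:ℝ)) (x i) := by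
  classical
  simp [obsCount, Set.indicator_apply]

lemma ae_tendsto_obsCount_cell {Ω : Type*} [MeasurableSpace Ω] {P : Measure Ω} {X : ℕ → Ω → ℝ}
    {ν : Measure ℝ} [IsProbabilityMeasure ν] (hX : ∀ i, Measurable (X i)) (hind : iIndepFun X P)
    (hlaw : ∀ i, P.map (X i) = ν) :
    ∀ᵐ ω ∂P, ∀ (N : ℕ) (k : ℤ), Tendsto (fun n : ℕ =>
      (obsCount (fun i => X i ω) n (cell (1 / (N + 1)) k) : ℝ) / n) atTop
      (𝓝 (ν.real (cell (1 / (N + 1)) k))) := by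
  rw [ae_all_iff]
  intro N
  rw [ae_all_iff]
  intro k
  have hm := measurableSet_cell (1 / (N + 1)) k
  filter_upwards [ae_tendsto_average hX hind hlaw (measurable_const.indicator hm)
    ((integrable_const (1:ℝ)).indicator hm)] with ω hω
  simp only [obsCount_eq_sum]
  rwa [integral_indicator_const _ hm, smul_eq_mul, mul_one] at hω

/-- The empirical distribution of `x 0, …, x (n - 1)`. -/
noncomputable def empirical (x : ℕ → ℝ) (n : ℕ) : Measure ℝ :=
  (n : ℝ≥0∞)⁻¹ • ∑ i ∈ Finset.range n, Measure.dirac (x i)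

lemma isProbabilityMeasure_empirical (x : ℕ → ℝ) {n : ℕ} (hn : n ≠ 0) :
    IsProbabilityMeasure (empirical x n) := by
  constructor
  simp only [empirical, Measure.smul_apply, Measure.finsetSum_apply, measure_univ,
    Finset.sum_const, Finset.card_range, smul_eq_mul, nsmul_eq_mul, mul_one]
  exact ENNReal.inv_mul_cancel (by exact_mod_cast hn) (ENNReal.natCast_ne_top n)

lemma integral_empirical (x : ℕ → ℝ) (n : ℕ) (g : ℝ → ℝ) :
    ∫ y, g y ∂(empirical x n) = (∑ i ∈ Finset.range n, g (x i)) / n := by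
  rw [empirical, integral_smul_measure, integral_finsetSum_measure]
  · simp [div_eq_inv_mul]
  · intro i _
    exact integrable_dirac (by simp)

lemma empirical_real (x : ℕ → ℝ) (n : ℕ) {s : Set ℝ} (hs : MeasurableSet s) :
    (empirical x n).real s = (obsCount x n s : ℝ) / n := by
  rw [obsCount_eq_sum, ← integral_empirical, integral_indicator_const _ hs, smul_eq_mul, mul_one]

/-- Approximation of the integral of a bounded Lipschitz function by a Riemann sum over finitely
many cells. -/
lemma abs_integral_sub_sum_cell_le (ρ : Measure ℝ) [IsProbabilityMeasure ρ] {g : ℝ → ℝ} {B L h : ℝ}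
    (hh : 0 < h) (hgm : Continuous g) (hL0 : 0 ≤ L) (hB : ∀ x, |g x| ≤ B)
    (hL : ∀ x y, |g x - g y| ≤ L * |x - y|) (T : Finset ℤ) :
    |∫ x, g x ∂ρ - ∑ k ∈ T, g (k * h) * ρ.real (cell h k)| ≤
      L * h + B * (1 - ∑ k ∈ T, ρ.real (cell h k)) := by
  have hB0 : 0 ≤ B := (abs_nonneg _).trans (hB 0)
  have hind : ∀ k, Integrable ((cell h k).indicator fun _ => (1:ℝ)) ρ := fun k =>
    (integrable_const (1:ℝ)).indicator (measurableSet_cell h k)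
  have hreal : ∀ k, ρ.real (cell h k) = ∫ x, (cell h k).indicator (fun _ => (1:ℝ)) x ∂ρ :=
    fun k => by rw [integral_indicator_const _ (measurableSet_cell h k), smul_eq_mul, mul_one]
  have hgint : Integrable g ρ := (integrable_const B).mono' hgm.aestronglyMeasurable
    (Eventually.of_forall hB)
  have hSint : Integrable (fun x => ∑ k ∈ T, g (k * h) * (cell h k).indicator (fun _ => (1:ℝ)) x)
    ρ := integrable_finsetSum _ fun k _ => (hind k).const_mul _
  have hTint : Integrable (fun x => ∑ k ∈ T, (cell h k).indicator (fun _ => (1:ℝ)) x) ρ :=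
    integrable_finsetSum _ fun k _ => hind k
  have hRint : Integrable
      (fun x => B * (1 - ∑ k ∈ T, (cell h k).indicator (fun _ => (1:ℝ)) x)) ρ :=
    ((integrable_const 1).sub hTint).const_mul B
  have e1 : ∑ k ∈ T, g (k * h) * ρ.real (cell h k) =
      ∫ x, ∑ k ∈ T, g (k * h) * (cell h k).indicator (fun _ => (1:ℝ)) x ∂ρ := by
    rw [integral_finsetSum _ fun k _ => (hind k).const_mul _]
    simp only [integral_const_mul, hreal]
  have e2 : L * h + B * (1 - ∑ k ∈ T, ρ.real (cell h k)) =
      ∫ x, L * h + B * (1 - ∑ k ∈ T, (cell h k).indicator (fun _ => (1:ℝ)) x) ∂ρ := by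
    rw [integral_add (integrable_const _) hRint,
      integral_const_mul B, integral_sub (integrable_const _) hTint,
      integral_finsetSum _ fun k _ => hind k]
    simp [hreal]
  rw [e1, e2, ← integral_sub hgint hSint]
  refine (abs_integral_le_integral_abs).trans (integral_mono (hgint.sub hSint).abs
    ((integrable_const _).add hRint) fun x => ?_)
  have hsum : ∀ f : ℤ → ℝ, ∑ k ∈ T, f k * (cell h k).indicator (fun _ => (1:ℝ)) x =
      if ⌊x / h⌋ ∈ T then f ⌊x / h⌋ else 0 := by
    intro f
    rw [← Finset.sum_ite_eq T ⌊x / h⌋ f]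
    refine Finset.sum_congr rfl fun k _ => ?_
    simp [cell, Set.indicator_apply]
  have h1 := hsum fun _ => 1
  simp only [one_mul] at h1
  simp only [h1, hsum fun k => g (k * h)]
  split_ifs with hx
  · have := cell_subset_Ico hh _ (show x ∈ cell h ⌊x / h⌋ from rfl)
    have hd : |x - ⌊x / h⌋ * h| ≤ h := by
      rw [abs_le]
      constructor <;> linarith [this.1, this.2]
    have := (hL x (⌊x / h⌋ * h)).trans (mul_le_mul_of_nonneg_left hd hL0)
    linarith
  · have : 0 ≤ L * h := by positivity
    rw [sub_zero]
    linarith [hB x]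

/-- Convergence of the relative frequencies of all cells of length `1 / (N + 1)` implies
convergence of the averages of bounded Lipschitz functions, uniformly over all functions with the
same bound and the same Lipschitz constant. -/
theorem eventually_forall_abs_average_sub_integral_le {x : ℕ → ℝ} {ν : Measure ℝ}
    [IsProbabilityMeasure ν]
    (hx : ∀ (N : ℕ) (k : ℤ), Tendsto (fun n : ℕ =>
      (obsCount x n (cell (1 / (N + 1)) k) : ℝ) / n) atTop (𝓝 (ν.real (cell (1 / (N + 1)) k))))
    {B L δ : ℝ} (hB : 0 < B) (hL : 0 < L) (hδ : 0 < δ) :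
    ∀ᶠ n : ℕ in atTop, ∀ g : ℝ → ℝ, (∀ y, |g y| ≤ B) → (∀ y z, |g y - g z| ≤ L * |y - z|) →
      |(∑ i ∈ Finset.range n, g (x i)) / n - ∫ y, g y ∂ν| ≤ δ := by
  obtain ⟨N, hN⟩ := exists_nat_one_div_lt (show 0 < δ / (4 * L) by positivity)
  set h : ℝ := 1 / (N + 1) with hh
  have hh0 : 0 < h := by positivity
  have hη : 0 < δ / (8 * B) := by positivity
  set η := δ / (8 * B) with hηdef
  have hν : HasSum (fun k => ν.real (cell h k)) 1 := by
    have h1 := tsum_measure_cell ν h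
    have h2 := ENNReal.hasSum_toReal (f := fun k => ν (cell h k)) (by simp [h1])
    rw [← ENNReal.tsum_toReal_eq (by simp), h1] at h2
    exact h2
  obtain ⟨T, hT⟩ := (hν.eventually_const_lt (show 1 - η < 1 by linarith)).exists
  have hconv : Tendsto (fun n : ℕ => ∑ k ∈ T, |(obsCount x n (cell h k) : ℝ) / n -
      ν.real (cell h k)|) atTop (𝓝 0) := by
    rw [show (0:ℝ) = ∑ k ∈ T, |ν.real (cell h k) - ν.real (cell h k)| by simp]
    exact tendsto_finsetSum _ fun k _ => ((hx N k).sub_const _).abs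
  filter_upwards [hconv.eventually_le_const hη, eventually_ne_atTop 0] with n hn hn0 g hgB hgL
  have hgc : Continuous g := by
    refine (LipschitzWith.of_dist_le_mul (K := ⟨L, hL.le⟩) fun y z => ?_).continuous
    rw [Real.dist_eq, Real.dist_eq]
    exact hgL y z
  have := isProbabilityMeasure_empirical x hn0
  have a1 := abs_integral_sub_sum_cell_le (empirical x n) hh0 hgc hL.le hgB hgL T
  have a2 := abs_integral_sub_sum_cell_le ν hh0 hgc hL.le hgB hgL T
  simp only [integral_empirical, empirical_real x n (measurableSet_cell h _)] at a1
  have a3 : |∑ k ∈ T, g (k * h) * ((obsCount x n (cell h k) : ℝ) / n) -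
      ∑ k ∈ T, g (k * h) * ν.real (cell h k)| ≤ B * η := by
    rw [← Finset.sum_sub_distrib]
    refine (Finset.abs_sum_le_sum_abs _ _).trans ?_
    refine le_trans ?_ (mul_le_mul_of_nonneg_left hn hB.le)
    rw [Finset.mul_sum]
    refine Finset.sum_le_sum fun k _ => ?_
    rw [← mul_sub, abs_mul]
    gcongr
    exact hgB _
  have a4 : ∑ k ∈ T, ν.real (cell h k) - ∑ k ∈ T, (obsCount x n (cell h k) : ℝ) / n ≤ η := by
    rw [← Finset.sum_sub_distrib]
    refine le_trans (Finset.sum_le_sum fun k _ => ?_) hn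
    rw [abs_sub_comm]
    exact le_abs_self _
  have b1 : L * h ≤ δ / 4 := by
    rw [lt_div_iff₀ (by positivity)] at hN
    linarith
  have b2 : B * η = δ / 8 := by
    rw [hηdef]; field_simp
  have b3 : B * (1 - ∑ k ∈ T, ν.real (cell h k)) ≤ B * η := by
    gcongr; linarith
  have b4 : B * (1 - ∑ k ∈ T, (obsCount x n (cell h k) : ℝ) / n) ≤ B * (2 * η) := by
    gcongr; linarith
  rw [abs_le] at a1 a2 a3 ⊢
  constructor <;> linarith [a1.1, a1.2, a2.1, a2.2, a3.1, a3.2]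

/-! ### Identifiability of finite normal mixtures -/

/-- In the lexicographic order of (standard deviation, mean), a normal density is negligible at
`+∞` relative to a larger one. -/
lemma tendsto_normalPDF_div {θ₁ s₁ θ₂ s₂ : ℝ} (h₁ : 0 < s₁) (h₂ : 0 < s₂)
    (h : s₁ < s₂ ∨ s₁ = s₂ ∧ θ₁ < θ₂) :
    Tendsto (fun x => normalPDF θ₁ s₁ x / normalPDF θ₂ s₂ x) atTop (𝓝 0) := by
  have key : Tendsto (fun x : ℝ => (x - θ₁) ^ 2 / (2 * s₁ ^ 2) - (x - θ₂) ^ 2 / (2 * s₂ ^ 2))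
      atTop atTop := by
    rcases h with h | ⟨rfl, h⟩
    · have hc : 0 < (2 * s₁ ^ 2)⁻¹ - (2 * s₂ ^ 2)⁻¹ := by
        rw [sub_pos]
        gcongr
      set c := (2 * s₁ ^ 2)⁻¹ - (2 * s₂ ^ 2)⁻¹
      set d := 2 * θ₂ * (2 * s₂ ^ 2)⁻¹ - 2 * θ₁ * (2 * s₁ ^ 2)⁻¹
      have e : (fun x : ℝ => (x - θ₁) ^ 2 / (2 * s₁ ^ 2) - (x - θ₂) ^ 2 / (2 * s₂ ^ 2)) =
          fun x => x * (c * x + d) + (θ₁ ^ 2 * (2 * s₁ ^ 2)⁻¹ - θ₂ ^ 2 * (2 * s₂ ^ 2)⁻¹) := by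
        ext x
        simp only [c, d, div_eq_mul_inv]
        ring
      rw [e]
      exact tendsto_atTop_add_const_right _ _ (tendsto_id.atTop_mul_atTop₀
        (tendsto_atTop_add_const_right _ _ (tendsto_id.const_mul_atTop hc)))
    · have hc : 0 < 2 * (θ₂ - θ₁) * (2 * s₁ ^ 2)⁻¹ := by
        have : 0 < θ₂ - θ₁ := sub_pos.2 h
        positivity
      have e : (fun x : ℝ => (x - θ₁) ^ 2 / (2 * s₁ ^ 2) - (x - θ₂) ^ 2 / (2 * s₁ ^ 2)) =
          fun x => 2 * (θ₂ - θ₁) * (2 * s₁ ^ 2)⁻¹ * x + (θ₁ ^ 2 - θ₂ ^ 2) * (2 * s₁ ^ 2)⁻¹ := by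
        ext x
        simp only [div_eq_mul_inv]
        ring
      rw [e]
      exact tendsto_atTop_add_const_right _ _ (tendsto_id.const_mul_atTop hc)
  have e : (fun x => normalPDF θ₁ s₁ x / normalPDF θ₂ s₂ x) = fun x => s₂ / s₁ *
      Real.exp (-((x - θ₁) ^ 2 / (2 * s₁ ^ 2) - (x - θ₂) ^ 2 / (2 * s₂ ^ 2))) := by
    ext x
    rw [normalPDF_eq h₁, normalPDF_eq h₂, neg_sub, Real.exp_sub, neg_div, neg_div, Real.exp_neg,
      Real.exp_neg]
    have hp : 0 < √(2 * Real.pi) := Real.sqrt_pos.2 (by positivity)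
    field_simp
  rw [e]
  simpa using (Real.tendsto_exp_atBot.comp (tendsto_neg_atTop_atBot.comp key)).const_mul (s₂ / s₁)

/-- Normal densities with distinct parameters are linearly independent. The index is the pair
(standard deviation, mean), ordered lexicographically. -/
lemma coeff_eq_zero_of_sum_normalPDF_eq_zero (S : Finset (ℝ ×ₗ ℝ)) (c : ℝ ×ₗ ℝ → ℝ)
    (hS : ∀ k ∈ S, 0 < (ofLex k).1)
    (h : ∀ x, ∑ k ∈ S, c k * normalPDF (ofLex k).2 (ofLex k).1 x = 0) :
    ∀ k ∈ S, c k = 0 := by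
  induction S using Finset.induction_on_max with
  | empty => simp
  | insert a S ha ih =>
    have hapos := hS a (Finset.mem_insert_self _ _)
    have hSpos : ∀ k ∈ S, 0 < (ofLex k).1 := fun k hk => hS k (Finset.mem_insert_of_mem hk)
    have haS : a ∉ S := fun h => lt_irrefl _ (ha a h)
    simp only [Finset.sum_insert haS] at h
    have hlim : Tendsto (fun x => ∑ k ∈ S, c k * (normalPDF (ofLex k).2 (ofLex k).1 x /
        normalPDF (ofLex a).2 (ofLex a).1 x)) atTop (𝓝 0) := by
      rw [show (0:ℝ) = ∑ k ∈ S, c k * 0 by simp]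
      refine tendsto_finsetSum _ fun k hk => ?_
      refine (tendsto_normalPDF_div (hSpos k hk) hapos ?_).const_mul _
      exact Prod.Lex.lt_iff.1 (ha k hk)
    have hca : c a = 0 := by
      have hconst : (fun x => ∑ k ∈ S, c k * (normalPDF (ofLex k).2 (ofLex k).1 x /
          normalPDF (ofLex a).2 (ofLex a).1 x)) = fun _ => -c a := by
        ext x
        have hp := normalPDF_pos hapos (ofLex a).2 x
        have e : ∀ k : ℝ ×ₗ ℝ, c k * (normalPDF (ofLex k).2 (ofLex k).1 x /
          normalPDF (ofLex a).2 (ofLex a).1 x) = c k * normalPDF (ofLex k).2 (ofLex k).1 x /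
          normalPDF (ofLex a).2 (ofLex a).1 x := fun k => by ring
        rw [Finset.sum_congr rfl fun k _ => e k, ← Finset.sum_div, div_eq_iff hp.ne']
        linarith [h x]
      rw [hconst] at hlim
      have := tendsto_nhds_unique hlim tendsto_const_nhds
      linarith
    intro k hk
    rcases Finset.mem_insert.1 hk with rfl | hk
    · exact hca
    · exact ih hSpos (fun x => by simpa [hca] using h x) k hk

lemma sum_mul_eq_zero_of_sum_normalPDF_eq_zero {ι : Type*} [Fintype ι] {c θ s : ι → ℝ}
    (hs : ∀ i, 0 < s i) (h : ∀ x, ∑ i, c i * normalPDF (θ i) (s i) x = 0) (g : ℝ → ℝ → ℝ) :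
    ∑ i, c i * g (θ i) (s i) = 0 := by
  classical
  let f : ι → ℝ ×ₗ ℝ := fun i => toLex (s i, θ i)
  have hfib : ∀ g : ℝ → ℝ → ℝ, ∑ i, c i * g (θ i) (s i) =
      ∑ k ∈ Finset.univ.image f, (∑ i with f i = k, c i) * g (ofLex k).2 (ofLex k).1 := by
    intro g
    rw [← Finset.sum_fiberwise_of_maps_to
      (fun i _ => Finset.mem_image_of_mem f (Finset.mem_univ i))]
    refine Finset.sum_congr rfl fun k _ => ?_
    rw [Finset.sum_mul]
    refine Finset.sum_congr rfl fun i hi => ?_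
    rw [← (Finset.mem_filter.1 hi).2]
    rfl
  have hz := coeff_eq_zero_of_sum_normalPDF_eq_zero (Finset.univ.image f)
    (fun k => ∑ i with f i = k, c i) ?_ ?_
  · rw [hfib]
    exact Finset.sum_eq_zero fun k hk => by rw [hz k hk, zero_mul]
  · intro k hk
    obtain ⟨i, -, rfl⟩ := Finset.mem_image.1 hk
    exact hs i
  · intro x
    rw [← hfib fun θ s => normalPDF θ s x]
    exact h x

/-- Equal normal mixtures have equal mixing distributions. -/
theorem sum_mul_eq_of_normalMix_eq {m : ℕ} {a θ s b t r : Fin m → ℝ} (hs : ∀ j, 0 < s j)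
    (hr : ∀ j, 0 < r j) (h : ∀ x, normalMix a θ s x = normalMix b t r x) (g : ℝ → ℝ → ℝ) :
    ∑ j, a j * g (θ j) (s j) = ∑ j, b j * g (t j) (r j) := by
  have := sum_mul_eq_zero_of_sum_normalPDF_eq_zero (ι := Fin m ⊕ Fin m)
    (c := Sum.elim a (fun j => -b j)) (θ := Sum.elim θ t) (s := Sum.elim s r)
    (by rintro (j | j); exacts [hs j, hr j]) (fun x => ?_) g
  · simp only [Fintype.sum_sum_type, Sum.elim_inl, Sum.elim_inr, neg_mul,
      Finset.sum_neg_distrib] at this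
    linarith
  · have := h x
    simp only [normalMix] at this
    simp only [Fintype.sum_sum_type, Sum.elim_inl, Sum.elim_inr, neg_mul, Finset.sum_neg_distrib]
    linarith

/-! ### The true density as the unique maximizer of the expected log-likelihood -/

/-- Jensen's inequality with its equality case: among the normal mixtures of total mass at most
one, only `f(·; G)` itself has an expected log-likelihood as large as that of `f(·; G)`. -/
lemma normalMix_eq_density_of_integral_log_le {m : ℕ} (G : NormalMixing m) {a θ s : Fin m → ℝ}
    (ha1 : ∑ j, a j ≤ 1) (hs : ∀ j, 0 < s j)
    (hpos : ∀ x, 0 < normalMix a θ s x)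
    (hint : Integrable (fun x => Real.log (normalMix a θ s x)) G.law)
    (h : ∫ x, Real.log (G.density x) ∂G.law ≤ ∫ x, Real.log (normalMix a θ s x) ∂G.law) (x : ℝ) :
    normalMix a θ s x = G.density x := by
  set H := normalMix a θ s
  have hq : Integrable (fun x => H x / G.density x) G.law := by
    rw [NormalMixing.integrable_law_iff]
    refine (integrable_normalMix (a := a) (θ := θ) (s := s)).congr
      (Eventually.of_forall fun x => ?_)
    exact (div_mul_cancel₀ _ (G.density_pos x).ne').symm
  have hqi : ∫ x, H x / G.density x ∂G.law ≤ 1 := by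
    rw [NormalMixing.integral_law]
    have : (fun x => G.density x * (H x / G.density x)) = H := by
      ext x
      exact mul_div_cancel₀ _ (G.density_pos x).ne'
    rw [this, integral_normalMix hs]
    exact ha1
  have hlog := G.integrable_log_density
  have hlog' : Integrable (fun x => Real.log (H x) - Real.log (G.density x)) G.law :=
    hint.sub hlog
  have hq1 : Integrable (fun x => H x / G.density x - 1) G.law := hq.sub (integrable_const 1)
  set D : ℝ → ℝ := fun x => H x / G.density x - 1 - (Real.log (H x) - Real.log (G.density x))
    with hD
  have hlogdiv : ∀ x, Real.log (H x) - Real.log (G.density x) = Real.log (H x / G.density x) :=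
    fun x => (Real.log_div (hpos x).ne' (G.density_pos x).ne').symm
  have hDnn : ∀ x, 0 ≤ D x := fun x => by
    simp only [hD, hlogdiv]
    linarith [Real.log_le_sub_one_of_pos (div_pos (hpos x) (G.density_pos x))]
  have hDint : Integrable D G.law := hq1.sub hlog'
  have hD0 : ∫ x, D x ∂G.law = 0 := by
    refine le_antisymm ?_ (integral_nonneg hDnn)
    rw [hD, integral_sub hq1 hlog', integral_sub hq (integrable_const 1), integral_sub hint hlog]
    simp only [integral_const, probReal_univ, smul_eq_mul, mul_one]
    linarith
  have hae := (integral_eq_zero_iff_of_nonneg hDnn hDint).1 hD0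
  have hae' : ∀ᵐ x, H x = G.density x := by
    filter_upwards [G.ae_volume_of_ae_law hae] with x hx
    by_contra hne
    have h1 : H x / G.density x ≠ 1 := fun h1 =>
      hne ((div_eq_one_iff_eq (G.density_pos x).ne').1 h1)
    have h2 := Real.log_lt_sub_one_of_pos (div_pos (hpos x) (G.density_pos x)) h1
    simp only [hD, hlogdiv, Pi.zero_apply] at hx
    linarith
  exact congrFun ((Continuous.ae_eq_iff_eq volume (continuous_normalMix hs)
    G.continuous_density).1 hae') x

/-- The offset `ε`, which the likelihood inequality needs because the limiting mixture may vanish,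
is removed here by dominated convergence. -/
theorem normalMix_eq_density_of_forall_integral_log_le {m : ℕ} (G : NormalMixing m)
    {a θ s : Fin m → ℝ} (ha : ∀ j, 0 ≤ a j) (ha1 : ∑ j, a j ≤ 1) (hs : ∀ j, 0 < s j)
    (h : ∀ ε > 0, ∫ x, Real.log (G.density x) ∂G.law ≤
      ∫ x, Real.log (normalMix a θ s x + ε) ∂G.law) (x : ℝ) :
    normalMix a θ s x = G.density x := by
  by_cases ha0 : ∀ j, a j = 0
  · have h1 := h (Real.exp (∫ x, Real.log (G.density x) ∂G.law - 1)) (Real.exp_pos _)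
    simp only [normalMix, ha0, zero_mul, Finset.sum_const_zero, zero_add, Real.log_exp,
      integral_const, probReal_univ, smul_eq_mul, one_mul] at h1
    linarith
  obtain ⟨j, hj⟩ := not_forall.1 ha0
  have hj : 0 < a j := lt_of_le_of_ne (ha j) (Ne.symm hj)
  have hpos : ∀ x, 0 < normalMix a θ s x := fun x =>
    Finset.sum_pos' (fun j _ => mul_nonneg (ha j) (normalPDF_nonneg _ _ _))
      ⟨j, Finset.mem_univ _, mul_pos hj (normalPDF_pos (hs j) _ _)⟩
  obtain ⟨j₀, -, hmin⟩ := Finset.exists_min_image Finset.univ s ⟨j, Finset.mem_univ _⟩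
  have hle : ∀ x, normalMix a θ s x ≤ (s j₀)⁻¹ := normalMix_le (hs j₀) ha ha1
    fun j => Or.inr (hmin j (Finset.mem_univ _))
  obtain ⟨C, hC⟩ := exists_abs_log_normalMix_le (B := (s j₀)⁻¹ + 1) (θ := θ) ha hs hj
  have hbound : ∀ ε, 0 ≤ ε → ε ≤ 1 → ∀ x,
      ‖Real.log (normalMix a θ s x + ε)‖ ≤ C * (1 + x ^ 2) := fun ε h0 h1 x =>
    hC x _ (by linarith) (by linarith [hle x])
  have hmeas : ∀ ε, Measurable fun x => Real.log (normalMix a θ s x + ε) := fun ε =>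
    ((continuous_normalMix hs).measurable.add_const ε).log
  have hCint := G.integrable_one_add_sq_law.const_mul C
  refine normalMix_eq_density_of_integral_log_le G ha1 hs hpos ?_ ?_ x
  · refine hCint.mono' (by simpa using (hmeas 0).aestronglyMeasurable)
      (Eventually.of_forall fun x => ?_)
    simpa using hbound 0 le_rfl zero_le_one x
  · have hlim : Tendsto (fun n : ℕ => ∫ x, Real.log (normalMix a θ s x + 1 / ((n : ℝ) + 1)) ∂G.law)
        atTop (𝓝 (∫ x, Real.log (normalMix a θ s x) ∂G.law)) := by
      refine tendsto_integral_of_dominated_convergence (fun x => C * (1 + x ^ 2))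
        (fun n => (hmeas _).aestronglyMeasurable) hCint (fun n => Eventually.of_forall
          (hbound _ (by positivity) ?_)) (Eventually.of_forall fun x => ?_)
      · rw [div_le_one (by positivity)]
        linarith [(Nat.cast_nonneg n : (0:ℝ) ≤ n)]
      · refine Tendsto.log ?_ (hpos x).ne'
        simpa using tendsto_one_div_add_atTop_nhds_zero_nat.const_add (normalMix a θ s x)
    exact ge_of_tendsto' hlim fun n => h _ (by positivity)

/-! ### Convergence in the Kiefer–Wolfowitz distance -/

namespace NormalMixing

variable {m : ℕ}

lemma cdf_nonneg (G : NormalMixing m) (t v : ℝ) : 0 ≤ G.cdf t v :=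
  Finset.sum_nonneg fun j _ => mul_nonneg (G.weight_nonneg j) (by split_ifs <;> simp)

lemma cdf_le_one (G : NormalMixing m) (t v : ℝ) : G.cdf t v ≤ 1 := by
  rw [← G.weight_sum]
  refine Finset.sum_le_sum fun j _ => mul_le_of_le_one_right (G.weight_nonneg j) ?_
  split_ifs <;> simp

lemma measurable_cdf (G : NormalMixing m) : Measurable fun z : ℝ × ℝ => G.cdf z.1 z.2 := by
  refine Finset.measurable_fun_sum _ fun j _ => Measurable.const_mul ?_ _
  refine Measurable.ite ?_ measurable_const measurable_const
  exact (measurableSet_le measurable_const measurable_fst).inter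
    (measurableSet_le measurable_const measurable_snd)

lemma integrable_exp_neg_abs : Integrable fun t : ℝ => Real.exp (-|t|) := by
  have h : IntegrableOn (fun t : ℝ => Real.exp (-|t|)) (Set.Ioi 0) :=
    (integrableOn_exp_neg_Ioi 0).congr_fun (fun t (ht : 0 < t) => by simp only [abs_of_pos ht])
      measurableSet_Ioi
  have h' : IntegrableOn (fun t : ℝ => Real.exp (-|t|)) (Set.Iic 0) :=
    (integrableOn_exp_Iic 0).congr_fun
      (fun t (ht : t ≤ 0) => by simp only [abs_of_nonpos ht, neg_neg]) measurableSet_Iic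
  rw [← integrableOn_univ, ← Set.Iic_union_Ioi (a := (0:ℝ))]
  exact h'.union h

lemma tendsto_kwDist {G : ℕ → NormalMixing m} {G₀ : NormalMixing m}
    (h : ∀ᵐ z : ℝ × ℝ, Tendsto (fun n => (G n).cdf z.1 z.2) atTop (𝓝 (G₀.cdf z.1 z.2))) :
    Tendsto (fun n => (G n).kwDist G₀) atTop (𝓝 0) := by
  have hint : Integrable (fun z : ℝ × ℝ => Real.exp (-(|z.1| + |z.2|))) := by
    refine (integrable_exp_neg_abs.mul_prod integrable_exp_neg_abs).congr
      (Eventually.of_forall fun z => ?_)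
    simp only [neg_add, Real.exp_add]
  rw [show (0:ℝ) = ∫ z in (Set.univ : Set ℝ) ×ˢ Set.Ioi (0 : ℝ), (0:ℝ) by simp]
  refine tendsto_integral_of_dominated_convergence (fun z : ℝ × ℝ => Real.exp (-(|z.1| + |z.2|)))
    (fun n => ?_) hint.integrableOn (fun n => Eventually.of_forall fun z => ?_) ?_
  · refine Measurable.aestronglyMeasurable ?_
    have h1 : Measurable fun z : ℝ × ℝ => |(G n).cdf z.1 z.2 - G₀.cdf z.1 z.2| :=
      ((G n).measurable_cdf.sub G₀.measurable_cdf).abs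
    exact h1.mul (by fun_prop)
  · rw [norm_mul, Real.norm_of_nonneg (Real.exp_pos _).le, Real.norm_eq_abs, abs_abs]
    refine mul_le_of_le_one_left (Real.exp_pos _).le ?_
    rw [abs_le]
    constructor <;> linarith [(G n).cdf_nonneg z.1 z.2, (G n).cdf_le_one z.1 z.2,
      G₀.cdf_nonneg z.1 z.2, G₀.cdf_le_one z.1 z.2]
  · filter_upwards [ae_restrict_of_ae h] with z hz
    have := ((hz.sub_const (G₀.cdf z.1 z.2)).abs).mul_const (Real.exp (-(|z.1| + |z.2|)))
    simpa using this

/-- If every component either has a vanishing weight in the limit or has converging parameters,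
and the limiting mixture has the density of `G₀`, then the mixing distributions converge. -/
theorem tendsto_kwDist_of_normalMix_eq {G : ℕ → NormalMixing m} {G₀ : NormalMixing m}
    {a t s : Fin m → ℝ} (hs : ∀ j, 0 < s j)
    (ha : ∀ j, Tendsto (fun n => (G n).weight j) atTop (𝓝 (a j)))
    (hlim : ∀ j, a j = 0 ∨ (Tendsto (fun n => (G n).mean j) atTop (𝓝 (t j)) ∧
      Tendsto (fun n => (G n).sd j) atTop (𝓝 (s j))))
    (heq : ∀ x, normalMix a t s x = G₀.density x) :
    Tendsto (fun n => (G n).kwDist G₀) atTop (𝓝 0) := by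
  classical
  refine tendsto_kwDist ?_
  have h1 : ∀ᵐ z : ℝ × ℝ, ∀ j, z.1 ≠ t j := ae_all_iff.2 fun j =>
    Measure.quasiMeasurePreserving_fst.ae (Measure.ae_ne volume (t j))
  have h2 : ∀ᵐ z : ℝ × ℝ, ∀ j, z.2 ≠ s j ^ 2 := ae_all_iff.2 fun j =>
    Measure.quasiMeasurePreserving_snd.ae (Measure.ae_ne volume (s j ^ 2))
  filter_upwards [h1, h2] with z hz1 hz2
  have hcdf : G₀.cdf z.1 z.2 =
      ∑ j, a j * (if t j ≤ z.1 ∧ s j ^ 2 ≤ z.2 then 1 else 0) := by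
    rw [sum_mul_eq_of_normalMix_eq hs G₀.sd_pos heq
      (fun t s => if t ≤ z.1 ∧ s ^ 2 ≤ z.2 then 1 else 0)]
    exact Finset.sum_congr rfl fun j _ => by congr
  rw [hcdf]
  refine tendsto_finsetSum _ fun j _ => ?_
  rcases hlim j with h0 | ⟨ht, hsd⟩
  · rw [h0, zero_mul]
    refine squeeze_zero (fun n => mul_nonneg ((G n).weight_nonneg j) (by split_ifs <;> simp))
      (fun n => mul_le_of_le_one_right ((G n).weight_nonneg j) (by split_ifs <;> simp)) ?_
    rw [← h0]
    exact ha j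
  · refine (ha j).mul (tendsto_nhds_of_eventually_eq ?_)
    have e1 : ∀ᶠ n in atTop, ((G n).mean j ≤ z.1 ↔ t j ≤ z.1) := by
      rcases lt_or_gt_of_ne (hz1 j) with hlt | hlt
      · filter_upwards [ht.eventually_const_lt hlt] with n hn
        exact iff_of_false hn.not_ge hlt.not_ge
      · filter_upwards [ht.eventually_lt_const hlt] with n hn
        exact iff_of_true hn.le hlt.le
    have e2 : ∀ᶠ n in atTop, ((G n).sd j ^ 2 ≤ z.2 ↔ s j ^ 2 ≤ z.2) := by
      have hsd2 := hsd.pow 2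
      rcases lt_or_gt_of_ne (hz2 j) with hlt | hlt
      · filter_upwards [hsd2.eventually_const_lt hlt] with n hn
        exact iff_of_false hn.not_ge hlt.not_ge
      · filter_upwards [hsd2.eventually_lt_const hlt] with n hn
        exact iff_of_true hn.le hlt.le
    filter_upwards [e1, e2] with n h1 h2
    simp only [h1, h2]

end NormalMixing

/-! ### Separating the degenerate components from the likelihood -/

lemma one_add_sum_le_prod_one_add {ι : Type*} (D : Finset ι) {y : ι → ℝ} (hy : ∀ j, 0 ≤ y j) :
    1 + ∑ j ∈ D, y j ≤ ∏ j ∈ D, (1 + y j) := by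
  classical
  induction D using Finset.induction_on with
  | empty => simp
  | insert i D hi ih =>
    rw [Finset.sum_insert hi, Finset.prod_insert hi]
    nlinarith [hy i, Finset.sum_nonneg fun j (_ : j ∈ D) => hy j]

lemma log_add_sum_le {ι : Type*} (D : Finset ι) {y : ι → ℝ} (hy : ∀ j, 0 ≤ y j) {h ε : ℝ}
    (hh : 0 ≤ h) (hε : 0 < ε) (hpos : 0 < h + ∑ j ∈ D, y j) :
    Real.log (h + ∑ j ∈ D, y j) ≤ Real.log (h + ε) + ∑ j ∈ D, Real.log (1 + y j / ε) := by
  have hy' : ∀ j, 0 ≤ y j / ε := fun j => div_nonneg (hy j) hε.le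
  rw [← Real.log_prod fun j _ => (by linarith [hy' j] : (0:ℝ) < 1 + y j / ε).ne']
  have hP := one_add_sum_le_prod_one_add D hy'
  rw [← Finset.sum_div] at hP
  have hS : 0 ≤ (∑ j ∈ D, y j) / ε := div_nonneg (Finset.sum_nonneg fun j _ => hy j) hε.le
  rw [← Real.log_mul (by positivity) (by linarith)]
  refine Real.log_le_log hpos ?_
  calc h + ∑ j ∈ D, y j = h + ε * ((∑ j ∈ D, y j) / ε) := by field_simp
    _ ≤ (h + ε) * (1 + (∑ j ∈ D, y j) / ε) := by nlinarith
    _ ≤ _ := by gcongr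

lemma abs_log_add_le {y B ε : ℝ} (hy : 0 ≤ y) (hyB : y ≤ B) (hε : 0 < ε) :
    |Real.log (y + ε)| ≤ |Real.log ε| + |Real.log (B + ε)| := by
  have h1 := Real.log_le_log hε (by linarith : ε ≤ y + ε)
  have h2 := Real.log_le_log (by linarith) (by linarith : y + ε ≤ B + ε)
  rw [abs_le]
  constructor <;> linarith [neg_abs_le (Real.log ε), le_abs_self (Real.log (B + ε)),
    abs_nonneg (Real.log ε), abs_nonneg (Real.log (B + ε))]

lemma abs_log_add_sub_le {y z ε : ℝ} (hy : 0 ≤ y) (hz : 0 ≤ z) (hε : 0 < ε) :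
    |Real.log (y + ε) - Real.log (z + ε)| ≤ ε⁻¹ * |y - z| := by
  have key : ∀ u v : ℝ, 0 ≤ u → 0 ≤ v →
      Real.log (u + ε) - Real.log (v + ε) ≤ ε⁻¹ * |u - v| := by
    intro u v hu hv
    rw [← Real.log_div (by positivity) (by positivity)]
    refine (Real.log_le_sub_one_of_pos (by positivity)).trans ?_
    rw [div_sub_one (by positivity), add_sub_add_right_eq_sub, div_eq_inv_mul]
    have : (v + ε)⁻¹ ≤ ε⁻¹ := inv_anti₀ hε (by linarith)
    calc (v + ε)⁻¹ * (u - v) ≤ (v + ε)⁻¹ * |u - v| := by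
          gcongr
          exact le_abs_self _
      _ ≤ _ := by gcongr
  refine abs_le.2 ⟨?_, key y z hy hz⟩
  have := key z y hz hy
  rw [abs_sub_comm] at this
  linarith

namespace NormalMixing

variable {m : ℕ}

lemma weight_le_one (G : NormalMixing m) (j : Fin m) : G.weight j ≤ 1 := by
  rw [← G.weight_sum]
  exact Finset.single_le_sum (fun j _ => G.weight_nonneg j) (Finset.mem_univ j)

open scoped Classical in
/-- The weights of the components outside `D`; those in `D` are set to zero. -/
noncomputable def weightOff (G : NormalMixing m) (D : Finset (Fin m)) (j : Fin m) : ℝ :=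
  if j ∈ D then 0 else G.weight j

lemma weightOff_nonneg (G : NormalMixing m) (D : Finset (Fin m)) (j : Fin m) :
    0 ≤ G.weightOff D j := by
  unfold weightOff
  split_ifs
  exacts [le_rfl, G.weight_nonneg j]

lemma weightOff_le (G : NormalMixing m) (D : Finset (Fin m)) (j : Fin m) :
    G.weightOff D j ≤ G.weight j := by
  unfold weightOff
  split_ifs
  exacts [G.weight_nonneg j, le_rfl]

lemma sum_weightOff_le_one (G : NormalMixing m) (D : Finset (Fin m)) :
    ∑ j, G.weightOff D j ≤ 1 :=
  (Finset.sum_le_sum fun j _ => G.weightOff_le D j).trans G.weight_sum.le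

/-- The density of the part of `G` formed by the components outside `D`. -/
noncomputable def densityOff (G : NormalMixing m) (D : Finset (Fin m)) : ℝ → ℝ :=
  normalMix (G.weightOff D) G.mean G.sd

lemma densityOff_nonneg (G : NormalMixing m) (D : Finset (Fin m)) (x : ℝ) :
    0 ≤ G.densityOff D x :=
  normalMix_nonneg (G.weightOff_nonneg D) x

lemma log_density_le (G : NormalMixing m) (D : Finset (Fin m)) {ε : ℝ} (hε : 0 < ε) (x : ℝ) :
    Real.log (G.density x) ≤ Real.log (G.densityOff D x + ε) +
      ∑ j ∈ D, Real.log (1 + normalPDF (G.mean j) (G.sd j) x / ε) := by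
  classical
  have hle : G.density x ≤ G.densityOff D x + ∑ j ∈ D, normalPDF (G.mean j) (G.sd j) x := by
    have e : ∑ j ∈ D, normalPDF (G.mean j) (G.sd j) x =
        ∑ j, if j ∈ D then normalPDF (G.mean j) (G.sd j) x else 0 := by
      rw [Finset.sum_ite_mem, Finset.univ_inter]
    rw [e, densityOff, normalMix, ← Finset.sum_add_distrib]
    refine Finset.sum_le_sum fun j _ => ?_
    have := mul_le_of_le_one_left (normalPDF_nonneg (G.mean j) (G.sd j) x) (G.weight_le_one j)
    unfold weightOff
    split_ifs
    · rw [zero_mul, zero_add]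
      exact this
    · rw [add_zero]
      exact le_rfl
  have hpos := G.density_pos x
  exact (Real.log_le_log hpos hle).trans (log_add_sum_le D (fun j => normalPDF_nonneg _ _ _)
    (G.densityOff_nonneg D x) hε (hpos.trans_le hle))

/-- The penalized log-likelihood exceeds the log-likelihood of the components outside `D` by at
most `m δ n` if the components in `D` satisfy the bound of `exists_sd_bound`. -/
lemma logLik_add_sum_le (G : NormalMixing m) (D : Finset (Fin m)) {ε δ : ℝ} (hε : 0 < ε)
    {x : ℕ → ℝ} {n : ℕ} {q : ℝ → ℝ}
    (hD : ∀ j ∈ D, ∑ i ∈ Finset.range n, Real.log (1 + normalPDF (G.mean j) (G.sd j) (x i) / ε) +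
      q (G.sd j) ≤ δ * n)
    (hq : ∀ j, q (G.sd j) ≤ δ * n) :
    logLik x n G + ∑ j, q (G.sd j) ≤
      ∑ i ∈ Finset.range n, Real.log (G.densityOff D (x i) + ε) + m * (δ * n) := by
  classical
  have h1 : logLik x n G ≤ ∑ i ∈ Finset.range n, Real.log (G.densityOff D (x i) + ε) +
      ∑ j ∈ D, ∑ i ∈ Finset.range n, Real.log (1 + normalPDF (G.mean j) (G.sd j) (x i) / ε) := by
    rw [Finset.sum_comm, ← Finset.sum_add_distrib]
    exact Finset.sum_le_sum fun i _ => G.log_density_le D hε (x i)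
  have h2 : ∑ j ∈ D, ∑ i ∈ Finset.range n,
      Real.log (1 + normalPDF (G.mean j) (G.sd j) (x i) / ε) + ∑ j, q (G.sd j) ≤ m * (δ * n) := by
    have e : ∀ f : Fin m → ℝ, ∑ j ∈ D, f j = ∑ j, if j ∈ D then f j else 0 := fun f => by
      rw [Finset.sum_ite_mem, Finset.univ_inter]
    rw [e, ← Finset.sum_add_distrib]
    refine (Finset.sum_le_card_nsmul _ _ (δ * n) fun j _ => ?_).trans (by simp)
    split_ifs with hj
    · exact hD j hj
    · rw [zero_add]
      exact hq j
  linarith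

/-! ### Limits of mixing distributions along subsequences -/

lemma exists_subseq_tendsto (G : ℕ → NormalMixing m) :
    ∃ ψ : ℕ → ℕ, StrictMono ψ ∧ ∃ (a : Fin m → ℝ) (τ ς : Fin m → EReal), ∀ j,
      Tendsto (fun k => (G (ψ k)).weight j) atTop (𝓝 (a j)) ∧
      Tendsto (fun k => ((G (ψ k)).mean j : EReal)) atTop (𝓝 (τ j)) ∧
      Tendsto (fun k => ((G (ψ k)).sd j : EReal)) atTop (𝓝 (ς j)) := by
  let Y : ℕ → Fin m → Set.Icc (0:ℝ) 1 × EReal × EReal := fun n j =>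
    (⟨(G n).weight j, (G n).weight_nonneg j, (G n).weight_le_one j⟩, (G n).mean j, (G n).sd j)
  obtain ⟨y, ψ, hψ, hy⟩ := CompactSpace.tendsto_subseq Y
  refine ⟨ψ, hψ, fun j => (y j).1, fun j => (y j).2.1, fun j => (y j).2.2, fun j => ?_⟩
  have hj := tendsto_pi_nhds.1 hy j
  have h1 := hj.fst_nhds
  have h2 := hj.snd_nhds
  exact ⟨(continuous_subtype_val.tendsto _).comp h1, h2.fst_nhds, h2.snd_nhds⟩

/-- Along a sequence of parameters that converges in the extended sense, a component
degenerates, converges to a normal component, or escapes, its density tending to zero. -/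
lemma component_trichotomy {θ s : ℕ → ℝ} (hs : ∀ n, 0 < s n) {τ ς : EReal}
    (hθτ : Tendsto (fun n => (θ n : EReal)) atTop (𝓝 τ))
    (hsς : Tendsto (fun n => (s n : EReal)) atTop (𝓝 ς)) :
    Tendsto s atTop (𝓝 0) ∨ (∃ t σ, 0 < σ ∧ Tendsto θ atTop (𝓝 t) ∧ Tendsto s atTop (𝓝 σ)) ∨
      ((∃ c > 0, ∀ᶠ n in atTop, c ≤ s n) ∧
        ∀ x, Tendsto (fun n => normalPDF (θ n) (s n) x) atTop (𝓝 0)) := by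
  have hs' : ∀ᶠ n in atTop, 0 < s n := Eventually.of_forall hs
  induction ς using EReal.rec with
  | bot =>
    have h := EReal.tendsto_coe_nhds_bot_iff.1 hsς
    obtain ⟨n, hn⟩ := (h.eventually_lt_atBot 0).exists
    exact absurd (hs n) hn.not_gt
  | top =>
    have h := EReal.tendsto_coe_nhds_top_iff.1 hsς
    exact Or.inr (Or.inr ⟨⟨1, one_pos, h.eventually_ge_atTop 1⟩,
      fun x => tendsto_normalPDF_zero_of_sd hs' h x⟩)
  | coe σ =>
    have h := EReal.tendsto_coe.1 hsς
    rcases (ge_of_tendsto' h fun n => (hs n).le).eq_or_lt with rfl | hσ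
    · exact Or.inl h
    have hc : ∃ c > 0, ∀ᶠ n in atTop, c ≤ s n :=
      ⟨σ / 2, by positivity, h.eventually_const_le (half_lt_self hσ)⟩
    induction τ using EReal.rec with
    | bot =>
      have ht := tendsto_abs_atBot_atTop.comp (EReal.tendsto_coe_nhds_bot_iff.1 hθτ)
      exact Or.inr (Or.inr ⟨hc, tendsto_normalPDF_zero_of_mean hs' hσ ht h⟩)
    | top =>
      have ht := tendsto_abs_atTop_atTop.comp (EReal.tendsto_coe_nhds_top_iff.1 hθτ)
      exact Or.inr (Or.inr ⟨hc, tendsto_normalPDF_zero_of_mean hs' hσ ht h⟩)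
    | coe t => exact Or.inr (Or.inl ⟨t, σ, hσ, EReal.tendsto_coe.1 hθτ, h⟩)

/-- Every sequence of mixing distributions has a subsequence whose non-degenerate part converges
to a normal mixture of total mass at most one. The set `D` collects the degenerate components. -/
lemma exists_subseq_limit (G : ℕ → NormalMixing m) :
    ∃ ψ : ℕ → ℕ, StrictMono ψ ∧ ∃ (D : Finset (Fin m)) (c : ℝ) (w a t s : Fin m → ℝ),
      0 < c ∧ (∀ j, 0 < s j) ∧ (∀ j, 0 ≤ a j) ∧ (∀ j, a j ≤ w j) ∧
      (∀ j, Tendsto (fun k => (G (ψ k)).weight j) atTop (𝓝 (w j))) ∧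
      (∀ j, a j = 0 ∨ (Tendsto (fun k => (G (ψ k)).mean j) atTop (𝓝 (t j)) ∧
        Tendsto (fun k => (G (ψ k)).sd j) atTop (𝓝 (s j)))) ∧
      (∀ j ∈ D, Tendsto (fun k => (G (ψ k)).sd j) atTop (𝓝 0)) ∧
      (∀ᶠ k in atTop, ∀ j ∉ D, c ≤ (G (ψ k)).sd j) ∧
      ∀ x, Tendsto (fun k => (G (ψ k)).densityOff D x) atTop (𝓝 (normalMix a t s x)) := by
  classical
  obtain ⟨ψ, hψ, w, τ, ς, hlim⟩ := exists_subseq_tendsto G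
  have hw0 : ∀ j, 0 ≤ w j := fun j => ge_of_tendsto' (hlim j).1 fun k => (G (ψ k)).weight_nonneg j
  have htri := fun j => component_trichotomy (fun k => (G (ψ k)).sd_pos j) (hlim j).2.1 (hlim j).2.2
  set D : Finset (Fin m) := {j | Tendsto (fun k => (G (ψ k)).sd j) atTop (𝓝 0)} with hD
  have hDmem : ∀ j, j ∈ D ↔ Tendsto (fun k => (G (ψ k)).sd j) atTop (𝓝 0) := by simp [hD]
  have hc : ∀ j, ∃ c > 0, j ∉ D → ∀ᶠ k in atTop, c ≤ (G (ψ k)).sd j := by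
    intro j
    rcases htri j with h | ⟨t, σ, hσ, -, h⟩ | ⟨⟨c, hc, h⟩, -⟩
    · exact ⟨1, one_pos, fun hj => absurd ((hDmem j).2 h) hj⟩
    · exact ⟨σ / 2, by positivity, fun _ => h.eventually_const_le (half_lt_self hσ)⟩
    · exact ⟨c, hc, fun _ => h⟩
  choose c hc0 hc using hc
  obtain ⟨c₀, hc₀, hc₀le⟩ : ∃ c₀ > 0, ∀ j, c₀ ≤ c j := by
    rcases isEmpty_or_nonempty (Fin m) with hm | hm
    · exact ⟨1, one_pos, fun j => hm.elim j⟩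
    · obtain ⟨j₀, -, h⟩ := Finset.exists_min_image Finset.univ c Finset.univ_nonempty
      exact ⟨c j₀, hc0 j₀, fun j => h j (Finset.mem_univ j)⟩
  have hpar : ∀ j, ∃ a t s : ℝ, 0 < s ∧ 0 ≤ a ∧ a ≤ w j ∧
      (a = 0 ∨ (Tendsto (fun k => (G (ψ k)).mean j) atTop (𝓝 t) ∧
        Tendsto (fun k => (G (ψ k)).sd j) atTop (𝓝 s))) ∧
      ∀ x, Tendsto (fun k => (G (ψ k)).weightOff D j *
        normalPDF ((G (ψ k)).mean j) ((G (ψ k)).sd j) x) atTop (𝓝 (a * normalPDF t s x)) := by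
    intro j
    rcases htri j with h | ⟨t, σ, hσ, ht, h⟩ | ⟨-, h⟩
    · refine ⟨0, 0, 1, one_pos, le_rfl, hw0 j, Or.inl rfl, fun x => ?_⟩
      simp [weightOff, (hDmem j).2 h]
    · refine ⟨w j, t, σ, hσ, hw0 j, le_rfl, Or.inr ⟨ht, h⟩, fun x => ?_⟩
      have hj : j ∉ D := fun hj => hσ.ne (tendsto_nhds_unique ((hDmem j).1 hj) h)
      simp only [weightOff, hj, if_false]
      exact (hlim j).1.mul (tendsto_normalPDF (Eventually.of_forall fun k => (G (ψ k)).sd_pos j)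
        hσ ht h x)
    · refine ⟨0, 0, 1, one_pos, le_rfl, hw0 j, Or.inl rfl, fun x => ?_⟩
      rw [zero_mul]
      exact squeeze_zero (fun k => mul_nonneg ((G (ψ k)).weightOff_nonneg D j)
        (normalPDF_nonneg _ _ _)) (fun k => mul_le_of_le_one_left (normalPDF_nonneg _ _ _)
          (((G (ψ k)).weightOff_le D j).trans ((G (ψ k)).weight_le_one j))) (h x)
  choose a t s hs ha haw hconv hpt using hpar
  refine ⟨ψ, hψ, D, c₀, w, a, t, s, hc₀, hs, ha, haw, fun j => (hlim j).1, hconv,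
    fun j hj => (hDmem j).1 hj, ?_, fun x => tendsto_finsetSum _ fun j _ => hpt j x⟩
  refine eventually_all.2 fun j => ?_
  by_cases hj : j ∈ D
  · exact Eventually.of_forall fun k h => absurd hj h
  · filter_upwards [hc j hj] with k hk _
    exact (hc₀le j).trans hk

end NormalMixing

/-! ### Consistency -/

namespace NormalMixing

variable {m : ℕ}

/-- Wald's inequality: if the non-degenerate parts of penalized maximum likelihood estimators
converge along the sample sizes `N k`, then the limit has at least the expected log-likelihood of
the true density, up to the offset `ε`. -/
theorem integral_log_density_le_of_isPenalizedMLE {G₀ : NormalMixing m} {x : ℕ → ℝ} {C : ℝ}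
    (hC : 0 < C)
    (hcount : ∀ᶠ n : ℕ in atTop, ∀ θ r : ℝ, 0 ≤ r →
      (obsCount x n (Metric.closedBall θ r) : ℝ) ≤ C * (n * r + Real.log n))
    (hcell : ∀ (N : ℕ) (k : ℤ), Tendsto (fun n : ℕ =>
      (obsCount x n (cell (1 / (N + 1)) k) : ℝ) / n) atTop (𝓝 (G₀.law.real (cell (1 / (N + 1)) k))))
    (hlog : Tendsto (fun n : ℕ => logLik x n G₀ / n) atTop
      (𝓝 (∫ y, Real.log (G₀.density y) ∂G₀.law)))
    {p : ℕ → NormalMixing m → ℝ} {q : ℕ → ℝ → ℝ} (hp : PenaltyAdditive p q)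
    (hq2 : PenaltyModerate q) (hq3 : PenaltySevere q) {N : ℕ → ℕ} (hN : Tendsto N atTop atTop)
    {G : ℕ → NormalMixing m} (hG : ∀ᶠ k in atTop, IsPenalizedMLE x (N k) (p (N k)) (G k))
    {D : Finset (Fin m)} {c : ℝ} (hc : 0 < c) {a t s : Fin m → ℝ}
    (hD : ∀ j ∈ D, Tendsto (fun k => (G k).sd j) atTop (𝓝 0))
    (hoff : ∀ᶠ k in atTop, ∀ j ∉ D, c ≤ (G k).sd j)
    (hpt : ∀ y, Tendsto (fun k => (G k).densityOff D y) atTop (𝓝 (normalMix a t s y)))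
    {ε : ℝ} (hε : 0 < ε) :
    ∫ y, Real.log (G₀.density y) ∂G₀.law ≤ ∫ y, Real.log (normalMix a t s y + ε) ∂G₀.law := by
  set I₀ := ∫ y, Real.log (G₀.density y) ∂G₀.law
  set I₁ := ∫ y, Real.log (normalMix a t s y + ε) ∂G₀.law
  set B := |Real.log ε| + |Real.log (c⁻¹ + ε)| + 1 with hBdef
  have hB : 0 < B := by positivity
  -- the offset densities are uniformly bounded and uniformly Lipschitz
  have hoff' : ∀ᶠ k in atTop, ∀ j, (G k).weightOff D j = 0 ∨ c ≤ (G k).sd j := by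
    filter_upwards [hoff] with k hk j
    by_cases hj : j ∈ D
    · exact Or.inl (by simp [weightOff, hj])
    · exact Or.inr (hk j hj)
  have hbound : ∀ᶠ k in atTop, ∀ y, |Real.log ((G k).densityOff D y + ε)| ≤ B := by
    filter_upwards [hoff'] with k hk y
    have := abs_log_add_le ((G k).densityOff_nonneg D y)
      (normalMix_le hc ((G k).weightOff_nonneg D) ((G k).sum_weightOff_le_one D) hk y) hε
    linarith
  have hlip : ∀ᶠ k in atTop, ∀ y z, |Real.log ((G k).densityOff D y + ε) -
      Real.log ((G k).densityOff D z + ε)| ≤ ε⁻¹ * (c ^ 2)⁻¹ * |y - z| := by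
    filter_upwards [hoff'] with k hk y z
    refine (abs_log_add_sub_le ((G k).densityOff_nonneg D y) ((G k).densityOff_nonneg D z)
      hε).trans ?_
    rw [mul_assoc]
    gcongr
    exact abs_normalMix_sub_le hc ((G k).weightOff_nonneg D) ((G k).sum_weightOff_le_one D) hk y z
  have hint : Tendsto (fun k => ∫ y, Real.log ((G k).densityOff D y + ε) ∂G₀.law) atTop
      (𝓝 I₁) := by
    refine tendsto_integral_filter_of_dominated_convergence (fun _ => B)
      (Eventually.of_forall fun k => ?_) ?_ (integrable_const B)
      (Eventually.of_forall fun y => ?_)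
    · exact ((continuous_normalMix (G k).sd_pos).measurable.add_const ε).log.aestronglyMeasurable
    · filter_upwards [hbound] with k hk using Eventually.of_forall hk
    · refine ((hpt y).add_const ε).log ?_
      have := ge_of_tendsto' (hpt y) fun k => (G k).densityOff_nonneg D y
      positivity
  refine le_of_forall_pos_le_add fun η hη => ?_
  -- the error terms below add up to `(2 m + 3) δ`
  obtain ⟨δ, hδ, hδη⟩ : ∃ δ > 0, (2 * m + 3) * δ ≤ η :=
    ⟨η / (2 * m + 3), by positivity, by rw [mul_div_cancel₀ _ (by positivity)]⟩
  obtain ⟨σ₀, hσ₀, hsd⟩ := exists_sd_bound hC hcount hq2 hq3 hε hδ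
  have hulln := eventually_forall_abs_average_sub_integral_le hcell hB
    (show 0 < ε⁻¹ * (c ^ 2)⁻¹ by positivity) hδ
  have hpen₀ : ∀ᶠ n : ℕ in atTop, ∀ j, -(δ * n) ≤ q n (G₀.sd j) := by
    refine eventually_all.2 fun j => ?_
    filter_upwards [(hq2.2 _ (G₀.sd_pos j)).def hδ] with n hn
    rw [Real.norm_eq_abs, Real.norm_eq_abs, Nat.abs_cast] at hn
    exact (abs_le.1 hn).1
  have hDsmall : ∀ᶠ k in atTop, ∀ j ∈ D, (G k).sd j < σ₀ :=
    (Finset.eventually_all D).2 fun j hj => (hD j hj).eventually_lt_const hσ₀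
  obtain ⟨k, hGk, hsdk, hullnk, hpenk, hDk, hbk, hlk, hintk, hlogk, hqk, hNk⟩ :=
    (hG.and <| (hN.eventually hsd).and <| (hN.eventually hulln).and <| (hN.eventually hpen₀).and <|
      hDsmall.and <| hbound.and <| hlip.and <|
      (hint.eventually_lt_const (show I₁ < I₁ + δ by linarith)).and <|
      (hN.eventually (hlog.eventually_const_lt (show I₀ - δ < I₀ by linarith))).and <|
      (hN.eventually (hq2.1 δ hδ)).and (hN.eventually_gt_atTop 0)).exists
  have hn : (0:ℝ) < N k := by exact_mod_cast hNk
  have h1 := hGk G₀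
  rw [hp, hp] at h1
  have h2 := (G k).logLik_add_sum_le D hε (x := x) (n := N k) (q := q (N k)) (δ := δ)
    (fun j hj => hsdk _ _ ((G k).sd_pos j) (hDk j hj))
    (fun j => (le_max_left _ _).trans (hqk _ ((G k).sd_pos j)))
  have h3 := (abs_le.1 (hullnk _ hbk hlk)).2
  have h4 : -(m * (δ * N k)) ≤ ∑ j, q (N k) (G₀.sd j) := by
    calc -(m * (δ * N k)) = ∑ _j : Fin m, -(δ * N k) := by simp
      _ ≤ _ := Finset.sum_le_sum fun j _ => hpenk j
  rw [lt_div_iff₀ hn] at hlogk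
  rw [sub_le_iff_le_add, div_le_iff₀ hn] at h3
  have h5 : (I₀ - δ) * N k ≤ (δ + (I₁ + δ) + 2 * m * δ) * N k := by
    have : (δ + ∫ y, Real.log ((G k).densityOff D y + ε) ∂G₀.law) * N k ≤
        (δ + (I₁ + δ)) * N k := by gcongr
    linarith
  have h6 := le_of_mul_le_mul_right h5 hn
  linarith

/-- Consistency of penalized maximum likelihood estimators for one sequence of observations. -/
theorem tendsto_kwDist_of_isPenalizedMLE {G₀ : NormalMixing m} {x : ℕ → ℝ} {C : ℝ}
    (hC : 0 < C)
    (hcount : ∀ᶠ n : ℕ in atTop, ∀ θ r : ℝ, 0 ≤ r →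
      (obsCount x n (Metric.closedBall θ r) : ℝ) ≤ C * (n * r + Real.log n))
    (hcell : ∀ (N : ℕ) (k : ℤ), Tendsto (fun n : ℕ =>
      (obsCount x n (cell (1 / (N + 1)) k) : ℝ) / n) atTop (𝓝 (G₀.law.real (cell (1 / (N + 1)) k))))
    (hlog : Tendsto (fun n : ℕ => logLik x n G₀ / n) atTop
      (𝓝 (∫ y, Real.log (G₀.density y) ∂G₀.law)))
    {p : ℕ → NormalMixing m → ℝ} {q : ℕ → ℝ → ℝ} (hp : PenaltyAdditive p q)
    (hq2 : PenaltyModerate q) (hq3 : PenaltySevere q) {G : ℕ → NormalMixing m}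
    (hG : ∀ᶠ n in atTop, IsPenalizedMLE x n (p n) (G n)) :
    Tendsto (fun n => (G n).kwDist G₀) atTop (𝓝 0) := by
  refine tendsto_of_subseq_tendsto fun ns hns => ?_
  obtain ⟨ψ, hψ, D, c, w, a, t, s, hc, hs, ha, haw, hw, hconv, hD, hoff, hpt⟩ :=
    exists_subseq_limit fun k => G (ns k)
  refine ⟨ψ, ?_⟩
  have hN : Tendsto (fun k => ns (ψ k)) atTop atTop := hns.comp hψ.tendsto_atTop
  have hw1 : ∑ j, w j = 1 := by
    refine tendsto_nhds_unique (tendsto_finsetSum _ fun j _ => hw j) ?_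
    simp only [weight_sum, tendsto_const_nhds]
  have ha1 : ∑ j, a j ≤ 1 := hw1 ▸ Finset.sum_le_sum fun j _ => haw j
  have heq : ∀ y, normalMix a t s y = G₀.density y :=
    normalMix_eq_density_of_forall_integral_log_le G₀ ha ha1 hs fun ε hε =>
      integral_log_density_le_of_isPenalizedMLE hC hcount hcell hlog hp hq2 hq3 hN
        (hN.eventually hG) hc hD hoff hpt hε
  -- no mass is lost in the limit, so the degenerate and escaping components have weight zero
  have hsum : ∑ j, a j = ∑ j, w j := by
    rw [hw1, ← integral_normalMix (θ := t) hs, funext heq, density_eq_normalMix,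
      integral_normalMix G₀.sd_pos, G₀.weight_sum]
  have haeq : ∀ j, a j = w j := fun j =>
    (Finset.sum_eq_sum_iff_of_le fun j _ => haw j).1 hsum j (Finset.mem_univ j)
  exact tendsto_kwDist_of_normalMix_eq hs (fun j => haeq j ▸ hw j) hconv heq

end NormalMixing

theorem mainTheorem5 {Ω : Type*} [MeasurableSpace Ω] (P : Measure Ω) [IsProbabilityMeasure P]
    (m : ℕ) (Gstar : NormalMixing m)
    (X : ℕ → Ω → ℝ) (hX_meas : ∀ i, Measurable (X i)) (hX_indep : iIndepFun X P)
    (hX_law : ∀ i, P.map (X i) = Gstar.law)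
    (p : ℕ → Ω → NormalMixing m → ℝ) (q : ℕ → Ω → ℝ → ℝ)
    (hP1 : ∀ᵐ ω ∂P, NormalMixing.PenaltyAdditive (fun n => p n ω) (fun n => q n ω))
    (hP2 : ∀ᵐ ω ∂P, PenaltyModerate (fun n => q n ω))
    (hP3 : ∀ᵐ ω ∂P, PenaltySevere (fun n => q n ω))
    (Gtilde : ℕ → Ω → NormalMixing m)
    (hG : ∀ᵐ ω ∂P, ∀ᶠ n : ℕ in atTop,
      NormalMixing.IsPenalizedMLE (fun i => X i ω) n (p n ω) (Gtilde n ω)) :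
    ∀ᵐ ω ∂P, Tendsto (fun n : ℕ => NormalMixing.kwDist (Gtilde n ω) Gstar) atTop (𝓝 0) := by
  obtain ⟨M, -, hM⟩ := Gstar.exists_density_le
  obtain ⟨C, hC, hcount⟩ :=
    ae_exists_obsCount_closedBall_le hX_meas hX_indep hX_law (Gstar.law_le hM)
  filter_upwards [hP1, hP2, hP3, hG, hcount, ae_tendsto_obsCount_cell hX_meas hX_indep hX_law,
    ae_tendsto_average hX_meas hX_indep hX_law Gstar.measurable_density.log
      Gstar.integrable_log_density] with ω h1 h2 h3 h4 h5 h6 h7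
  exact NormalMixing.tendsto_kwDist_of_isPenalizedMLE hC h5 h6 h7 h1 h2 h3 h4
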